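/- Let $T$ be the infinite rooted binary tree, whose vertices are the finite words over $\{0,1\}$. For a subgroup $G\le\operatorname{Aut}T$ let $G \bmod m$ be the quotient of $G$ by the fixator in $G$ of the $m$-th level, and let $$\dim_H G=\liminf_{m\to\infty}\frac{\log|G\bmod m|}{\log|\operatorname{Aut}T\bmod m|}.$$ Let $B$ be a finite-dimensional vector space over $\mathbb Z/2\mathbb Z$ with dual $B^*$, and let $\omega=\omega_1\omega_2\dots$ be a sequence of non-zero elements of $B^*$. The spinal group $G_\omega\le\operatorname{Aut}T$ is generated by the automorphism $a$ that exchanges the two maximal subtrees and by the automorphisms $b=\langle\omega_1(b),b_1\rangle$, $b_k=\langle\omega_{k+1}(b),b_{k+1}\rangle$ ($k\ge1$) for $b\in B$, where $\langle g,h\rangle$ acts by $g$ on the subtree below $0$ and by $h$ on the subtree below $1$, and the element $1$ (resp. $0$) of $\mathbb Z/2\mathbb Z$ acts as $a$ (resp. trivially). For $m\ge1$ let $\dim(\omega\bmod m)$ be the dimension of the span of $\omega_1,\dots,\omega_{m-1}$, let $\sigma\omega=\omega_2\omega_3\dots$, and put $$\operatorname{diminf}(\omega)=\liminf_{n\to\infty}\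 \lim_{m\to\infty}\dim(\sigma^n\omega\bmod m).$$ 1. If $\operatorname{diminf}(\omega)=2$, then $\omega$ has a syllable form $\omega=\psi_1^{a_1}\psi_2^{a_2}\dots$ with infinitely many syllables, $a_k\ge1$ and $\psi_k\ne\psi_{k+1}$, and with $s_k=a_1+\dots+a_k$ and $\Sigma_k=\sum_{j=1}^k2^{s_{j-1}}a_j$, $$\dim_H G_\omega=\frac12\liminf_{k\to\infty}\left(\frac{\Sigma_k}{2^{s_k}}+\frac1{2^{a_k}}\Bigl(1-\frac1{2^{a_{k-1}}}\Bigr)\right).$$ 2. If $\dim B=2$ and $\omega=\omega_1\omega_2\omega_3\omega_1\omega_2\omega_3\dots$, where $\omega_1,\omega_2,\omega_3$ are the three non-zero elements of $B^*$, so that $G_\omega$ is the first Grigorchuk group, then $\dim_H G_\omega=\frac58$. 3. If $n\ge2$, $\dim B=n$, and $\omega=\omega_1\dots\omega_n\omega_1\dots\omega_n\dots$, where $\omega_1,\dots,\omega_n$ is a basis of $B^*$, then $G_n=G_\omega$ satisfies $\dim_H G_n=1-\frac3{2^{n+1}}$. -/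

import Mathlib

open Filter

/-- The vertices of the binary rooted tree: finite words over the alphabet `{0, 1}`, the alphabet
being identified with `ℤ/2ℤ`. The root is the empty word and the children of `w` are the words
`w ++ [x]`. -/
abbrev Vertex : Type := List (ZMod 2)

/-- The automorphism group of the binary rooted tree: the permutations of the vertices that
preserve the levels and the relation "is an ancestor of" (the prefix relation). -/
def TreeAut : Subgroup (Equiv.Perm Vertex) where
  carrier := {g | (∀ w, (g w).length = w.length) ∧ ∀ u v, g u <+: g v ↔ u <+: v}
  one_mem' := ⟨fun _ => rfl, fun _ _ => Iff.rfl⟩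
  mul_mem' := by
    rintro g h ⟨hg, hg'⟩ ⟨hh, hh'⟩
    exact ⟨fun w => (hg (h w)).trans (hh w), fun u v => (hg' (h u) (h v)).trans (hh' u v)⟩
  inv_mem' := by
    rintro g ⟨hg, hg'⟩
    refine ⟨fun w => ?_, fun u v => ?_⟩
    · have h := hg (g⁻¹ w)
      rw [show g (g⁻¹ w) = w from Equiv.apply_symm_apply g w] at h
      exact h.symm
    · have h := hg' (g⁻¹ u) (g⁻¹ v)
      rw [show g (g⁻¹ u) = u from Equiv.apply_symm_apply g u,
        show g (g⁻¹ v) = v from Equiv.apply_symm_apply g v] at h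
      exact h.symm

/-- The fixator in `Aut T` of the `m`-th level of the tree. -/
def levelStab (m : ℕ) : Subgroup TreeAut where
  carrier := {g | ∀ w : Vertex, w.length = m → g.1 w = w}
  one_mem' := fun _ _ => rfl
  mul_mem' := by
    intro g h hg hh w hw
    change g.1 (h.1 w) = w
    rw [hh w hw, hg w hw]
  inv_mem' := by
    intro g hg w hw
    change g.1⁻¹ w = w
    rw [Equiv.Perm.inv_eq_iff_eq]
    exact (hg w hw).symm

/-- The order of `G mod m`, the quotient of `G` by the fixator in `G` of the `m`-th level. -/
noncomputable def cardMod (G : Subgroup TreeAut) (m : ℕ) : ℕ :=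
  Nat.card (G ⧸ (levelStab m).subgroupOf G)

/-- The Hausdorff dimension of a group `G` of automorphisms of the binary rooted tree:
`liminf log |G mod m| / log |Aut T mod m|`. All the ratios lie in `[0, 1]`. -/
noncomputable def hausdorffDim (G : Subgroup TreeAut) : ℝ :=
  liminf (fun m : ℕ => Real.log (cardMod G m) / Real.log (cardMod ⊤ m)) atTop

/-- The element `c` of `ℤ/2ℤ = Sym {0, 1}` acting on the first letter of each word. -/
def rootFun (c : ZMod 2) : Vertex → Vertex
  | [] => []
  | x :: w => (x + c) :: w

/-- The map defined recursively by `f_c = ⟨c₀, f_{σc}⟩`, where `σc = (c₁, c₂, …)`: below the vertex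
`0` it acts by `c₀` on the next letter, and below the vertex `1` by the map of the shifted
sequence. -/
def spineFun : (ℕ → ZMod 2) → Vertex → Vertex
  | _, [] => []
  | c, x :: w => if x = 0 then x :: rootFun (c 0) w else x :: spineFun (fun i => c (i + 1)) w

theorem rootFun_invol (c : ZMod 2) : Function.Involutive (rootFun c) := by
  intro w
  cases w with
  | nil => rfl
  | cons x w =>
    simp only [rootFun, add_assoc, CharTwo.add_self_eq_zero, add_zero]

theorem rootFun_length (c : ZMod 2) (w : Vertex) : (rootFun c w).length = w.length := by
  cases w <;> rfl

theorem rootFun_prefix (c : ZMod 2) {u v : Vertex} (h : u <+: v) :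
    rootFun c u <+: rootFun c v := by
  cases u with
  | nil => exact List.nil_prefix
  | cons x u =>
    cases v with
    | nil => simp at h
    | cons y v =>
      obtain ⟨rfl, h'⟩ := List.cons_prefix_cons.1 h
      exact List.cons_prefix_cons.2 ⟨rfl, h'⟩

theorem spineFun_invol (c : ℕ → ZMod 2) : Function.Involutive (spineFun c) := by
  intro w
  induction w generalizing c with
  | nil => rfl
  | cons x w ih =>
    by_cases hx : x = 0
    · simp [spineFun, hx, rootFun_invol (c 0) w]
    · simp [spineFun, hx, ih]

theorem spineFun_length (c : ℕ → ZMod 2) (w : Vertex) : (spineFun c w).length = w.length := by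
  induction w generalizing c with
  | nil => rfl
  | cons x w ih =>
    by_cases hx : x = 0
    · simp [spineFun, hx, rootFun_length]
    · simp [spineFun, hx, ih]

theorem spineFun_prefix (c : ℕ → ZMod 2) {u v : Vertex} (h : u <+: v) :
    spineFun c u <+: spineFun c v := by
  induction u generalizing c v with
  | nil => simp [spineFun]
  | cons x u ih =>
    cases v with
    | nil => simp at h
    | cons y v =>
      obtain ⟨rfl, h'⟩ := List.cons_prefix_cons.1 h
      by_cases hx : x = 0
      · simpa [spineFun, hx] using rootFun_prefix (c 0) h'
      · simpa [spineFun, hx] using ih _ h'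

/-- The automorphism `a` of the tree that exchanges the two maximal subtrees. -/
def rootSwap : TreeAut :=
  ⟨(rootFun_invol 1).toPerm, rootFun_length 1, fun u v =>
    ⟨fun h => by
      have h' := rootFun_prefix 1 h
      change rootFun 1 (rootFun 1 u) <+: rootFun 1 (rootFun 1 v) at h'
      rwa [rootFun_invol 1 u, rootFun_invol 1 v] at h', rootFun_prefix 1⟩⟩

/-- The automorphism `⟨c₀, ⟨c₁, ⟨c₂, …⟩⟩⟩` of the tree, which acts by `c_k` on the letter that
follows the prefix `1^k 0`. -/
def spineAut (c : ℕ → ZMod 2) : TreeAut :=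
  ⟨(spineFun_invol c).toPerm, spineFun_length c, fun u v =>
    ⟨fun h => by
      have h' := spineFun_prefix c h
      change spineFun c (spineFun c u) <+: spineFun c (spineFun c v) at h'
      rwa [spineFun_invol c u, spineFun_invol c v] at h', spineFun_prefix c⟩⟩

section Spinal

variable {B : Type*} [AddCommGroup B] [Module (ZMod 2) B]

/-- The spinal group `G_ω` of a sequence `ω = ω₁ω₂…` of functionals on `B` (`ω i` is `ω_{i+1}`):
the group generated by `a` and the automorphisms by which the elements `b` of `B` act, namely
`b = ⟨ω₁(b), b@1⟩` and `b@1^k = ⟨ω_{k+1}(b), b@1^{k+1}⟩`. -/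
def spinalGroup (ω : ℕ → Module.Dual (ZMod 2) B) : Subgroup TreeAut :=
  Subgroup.closure ({rootSwap} ∪ Set.range fun b : B => spineAut fun i => ω i b)

/-- `dim (ω mod m)`: the dimension of the space spanned by the functionals that appear in the
prefix of `ω` of length `m - 1` (those that can be seen on the first `m` levels of the tree). -/
noncomputable def dimMod (ω : ℕ → Module.Dual (ZMod 2) B) (m : ℕ) : ℕ :=
  Module.finrank (ZMod 2) (Submodule.span (ZMod 2) (ω '' {i | i < m - 1}))

/-- `diminf ω = liminf_n lim_m dim (σⁿω mod m)`, where `σ` is the shift. -/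
noncomputable def diminf (ω : ℕ → Module.Dual (ZMod 2) B) : ℕ :=
  liminf (fun n : ℕ => limUnder atTop fun m : ℕ => dimMod (fun i => ω (i + n)) m) atTop

/-- The length `s_k = a₁ + ⋯ + a_k` of the first `k` syllables (`a i` is `a_{i+1}`). -/
def sylSum (a : ℕ → ℕ) (k : ℕ) : ℕ := ∑ i ∈ Finset.range k, a i

/-- `Σ_k = ∑_{j=1}^k 2^{s_{j-1}} a_j` (`a i` is `a_{i+1}`). -/
def bigSigma (a : ℕ → ℕ) (k : ℕ) : ℕ := ∑ j ∈ Finset.range k, 2 ^ sylSum a j * a j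

/-- The syllable form of `ω` is `ψ₁^{a₁}ψ₂^{a₂}…` (`ψ i` is `ψ_{i+1}` and `a i` is `a_{i+1}`):
the lengths of the syllables are positive, consecutive syllables have distinct letters, and the
letter of `ω` at each of the places of the `k`-th syllable is the letter of that syllable. -/
structure IsSyllableForm (ω ψ : ℕ → Module.Dual (ZMod 2) B) (a : ℕ → ℕ) : Prop where
  pos : ∀ k, 0 < a k
  ne : ∀ k, ψ k ≠ ψ (k + 1)
  eq : ∀ k i, sylSum a k ≤ i → i < sylSum a (k + 1) → ω i = ψ k

end Spinal

/-! Put L_ω(m) = log₂ |G_ω mod m|. Since log₂ |Aut T mod m| = 2^m - 1, the theorem is about the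
growth of L_ω(m) / 2^m, and it rests on a recursion that compares ω with its shift.

Let Γ = G_{σω}. Taking sections embeds the fixator of the first level of G_ω in Γ × Γ; its image P
is generated by the pairs (ω₁(b), b) and (b, ω₁(b)). Let N be the normal closure of ker ω₁ in Γ.
Then P contains N × N. All b with ω₁(b) = 1 have one image y in Γ/N, so Γ/N is generated by two
involutions x = a and y, and P/(N × N) is generated by (x, y) and (y, x): both are dihedral,
possibly degenerate. Counting modulo the j-th level, with q the order of xy there, gives |G_ω mod
(j+1)| = |Γ mod j|² / q if y ≠ 1, and 2 |Γ mod j|² if y = 1 (`cardMod_spinalGroup_succ_of_ne_one`,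
`cardMod_spinalGroup_succ_of_eq_one`).

The order q is found for an arbitrary functional φ in place of ω₁. If φ is outside the span of the
letters visible on the level, some b with φ(b) = 1 acts trivially there, so y = 1 and q = 2. If φ is
in that span and is not the first letter, then q = 4. If φ is the first letter, then (ab)² has
sections ba and ab, and q is twice the order for the shifted sequence. Hence q is 2^(r+2) or
2^(r+1), where r counts the immediate repetitions of ω₁, and L_ω(j+1) is 2 L_{σω}(j) plus 1, or
minus r+2, or minus r+1.

For the periodic sequences r = 0: L(m+1) = 2L(m) + 1 as long as the visible letters are independent,
then L(m+1) = 2L(m) - 2, which gives 1 - 3/2^(p+1). When diminf ω = 2, two consecutive syllables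
eventually span all later letters, so only the last two syllables visible on a level are
exceptional; the other contributions telescope to Σ_k. The resulting ratio decreases while the level
runs through a syllable, so the liminf can be taken along the ends of the syllables. -/

theorem zmod_two_forall {p : ZMod 2 → Prop} : (∀ x, p x) ↔ p 0 ∧ p 1 := Fin.forall_fin_two

/-! ### Action on the first level, sections, fixators of levels, pairs of automorphisms. -/

theorem prefix_singleton_apply (g : TreeAut) (x : ZMod 2) (w : Vertex) :
    ∃ y v, g.1 [x] = [y] ∧ g.1 (x :: w) = y :: v := by
  have h1 : (g.1 [x]).length = 1 := g.2.1 [x]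
  obtain ⟨y, hy⟩ := List.length_eq_one_iff.1 h1
  have h2 : g.1 [x] <+: g.1 (x :: w) := (g.2.2 _ _).2 (by simp)
  rw [hy] at h2
  obtain ⟨t, ht⟩ := h2
  exact ⟨y, t, hy, ht.symm⟩

/-- The permutation of the two letters induced by a tree automorphism, as an element of `ℤ/2ℤ`. -/
def rootAct (g : TreeAut) : ZMod 2 := (g.1 [0]).headD 0

theorem apply_singleton (g : TreeAut) (x : ZMod 2) : g.1 [x] = [x + rootAct g] := by
  obtain ⟨y, -, hy, -⟩ := prefix_singleton_apply g 0 []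
  obtain ⟨z, -, hz, -⟩ := prefix_singleton_apply g 1 []
  have hyz : y ≠ z := by
    rintro rfl
    have := g.1.injective (hy.trans hz.symm)
    simp at this
  have hact : rootAct g = y := by simp [rootAct, hy]
  rw [hact]
  revert x
  refine zmod_two_forall.2 ⟨by rw [hy, zero_add], ?_⟩
  have : z = 1 + y := by
    clear hy hz hact
    decide +revert
  rw [hz, this]

/-- The action of a tree automorphism on the subtree below the letter `x`. -/
def sectionFun (g : TreeAut) (x : ZMod 2) (w : Vertex) : Vertex := (g.1 (x :: w)).tail

theorem apply_cons_sectionFun (g : TreeAut) (x : ZMod 2) (w : Vertex) :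
    g.1 (x :: w) = (x + rootAct g) :: sectionFun g x w := by
  obtain ⟨y, v, hy, hv⟩ := prefix_singleton_apply g x w
  rw [apply_singleton] at hy
  simp only [List.cons.injEq, and_true] at hy
  rw [sectionFun, hv, List.tail_cons, hy]

theorem rootAct_mul (g h : TreeAut) : rootAct (g * h) = rootAct g + rootAct h := by
  have h1 : (g * h).1 [0] = g.1 (h.1 [0]) := rfl
  rw [apply_singleton, apply_singleton, apply_singleton] at h1
  simpa [add_comm] using h1

theorem rootAct_one : rootAct 1 = 0 := rfl

/-- The action on the first level as a homomorphism. -/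
def rootActHom : TreeAut →* Multiplicative (ZMod 2) where
  toFun g := Multiplicative.ofAdd (rootAct g)
  map_one' := rfl
  map_mul' g h := by rw [rootAct_mul]; rfl

theorem rootAct_inv (g : TreeAut) : rootAct g⁻¹ = rootAct g := by
  have h := rootAct_mul g⁻¹ g
  rw [inv_mul_cancel, rootAct_one] at h
  generalize rootAct g⁻¹ = x at *
  generalize rootAct g = y at *
  decide +revert

theorem sectionFun_inv (g : TreeAut) (x : ZMod 2) (w : Vertex) :
    sectionFun g⁻¹ (x + rootAct g) (sectionFun g x w) = w := by
  have h : (g⁻¹).1 (g.1 (x :: w)) = x :: w := Equiv.symm_apply_apply g.1 _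
  rw [apply_cons_sectionFun g, apply_cons_sectionFun g⁻¹] at h
  exact (List.cons.inj h).2

/-- The section of a tree automorphism at the letter `x`. -/
def sectionAt (g : TreeAut) (x : ZMod 2) : TreeAut :=
  ⟨{ toFun := sectionFun g x
     invFun := sectionFun g⁻¹ (x + rootAct g)
     left_inv := sectionFun_inv g x
     right_inv := fun w => by
      have h := sectionFun_inv g⁻¹ (x + rootAct g) w
      rwa [rootAct_inv, inv_inv, add_assoc, CharTwo.add_self_eq_zero, add_zero] at h },
   fun w => by
    have h := g.2.1 (x :: w)
    rw [apply_cons_sectionFun] at h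
    simpa using h,
   fun u v => by
    have h := g.2.2 (x :: u) (x :: v)
    rw [apply_cons_sectionFun, apply_cons_sectionFun, List.cons_prefix_cons,
      List.cons_prefix_cons] at h
    simpa using h⟩

theorem apply_cons (g : TreeAut) (x : ZMod 2) (w : Vertex) :
    g.1 (x :: w) = (x + rootAct g) :: (sectionAt g x).1 w := apply_cons_sectionFun g x w

theorem apply_nil (g : TreeAut) : g.1 [] = [] := List.length_eq_zero_iff.1 (g.2.1 [])

theorem treeAut_ext {g h : TreeAut} (h0 : rootAct g = rootAct h)
    (h1 : ∀ x, sectionAt g x = sectionAt h x) : g = h := by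
  apply Subtype.ext
  apply Equiv.ext
  rintro (_ | ⟨x, w⟩)
  · rw [apply_nil, apply_nil]
  · rw [apply_cons, apply_cons, h0, h1]

theorem sectionAt_eq {g k : TreeAut} {x y : ZMod 2} (h : ∀ w, g.1 (x :: w) = y :: k.1 w) :
    rootAct g = y - x ∧ sectionAt g x = k := by
  have h' : ∀ w, x + rootAct g = y ∧ (sectionAt g x).1 w = k.1 w := fun w => by
    have := h w
    rw [apply_cons] at this
    exact List.cons.inj this
  exact ⟨by rw [← (h' []).1]; ring, Subtype.ext (Equiv.ext fun w => (h' w).2)⟩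

theorem sectionAt_mul (g h : TreeAut) (x : ZMod 2) :
    sectionAt (g * h) x = sectionAt g (x + rootAct h) * sectionAt h x := by
  refine (sectionAt_eq (y := x + rootAct h + rootAct g) fun w => ?_).2
  have h1 : (g * h).1 (x :: w) = g.1 (h.1 (x :: w)) := rfl
  rw [h1, apply_cons, apply_cons]
  rfl

theorem sectionAt_one (x : ZMod 2) : sectionAt 1 x = 1 :=
  (sectionAt_eq (y := x) fun _ => rfl).2

theorem sectionAt_inv (g : TreeAut) (x : ZMod 2) :
    sectionAt g⁻¹ x = (sectionAt g (x + rootAct g))⁻¹ := by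
  have h := sectionAt_mul g g⁻¹ x
  rw [mul_inv_cancel, sectionAt_one, rootAct_inv] at h
  exact eq_inv_of_mul_eq_one_right h.symm

theorem mem_levelStab_succ {g : TreeAut} {m : ℕ} :
    g ∈ levelStab (m + 1) ↔ rootAct g = 0 ∧ ∀ x, sectionAt g x ∈ levelStab m := by
  constructor
  · intro h
    have key : ∀ x w, w.length = m → x + rootAct g = x ∧ (sectionAt g x).1 w = w := fun x w hw => by
      have h1 : g.1 (x :: w) = x :: w := h (x :: w) (by simp [hw])
      rw [apply_cons] at h1
      exact List.cons.inj h1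
    refine ⟨?_, fun x w hw => (key x w hw).2⟩
    simpa using (key 0 (List.replicate m 0) (by simp)).1
  · rintro ⟨h0, h1⟩ (_ | ⟨x, w⟩) hw
    · simp at hw
    · rw [apply_cons, h0, add_zero]
      congr 1
      exact h1 x w (by simpa using hw)

theorem levelStab_zero : levelStab 0 = ⊤ := by
  refine eq_top_iff.2 fun g _ w hw => ?_
  rw [List.length_eq_zero_iff.1 hw, apply_nil]

theorem mem_levelStab_one {g : TreeAut} : g ∈ levelStab 1 ↔ rootAct g = 0 := by
  rw [mem_levelStab_succ, levelStab_zero]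
  simp

theorem levelStab_antitone {m n : ℕ} (h : m ≤ n) : levelStab n ≤ levelStab m := by
  induction m generalizing n with
  | zero => rw [levelStab_zero]; exact le_top
  | succ m ih =>
    obtain ⟨n, rfl⟩ := Nat.exists_eq_add_of_le' (lt_of_lt_of_le (Nat.succ_pos m) h)
    intro g hg
    rw [mem_levelStab_succ] at hg ⊢
    exact ⟨hg.1, fun x => ih (by omega) (hg.2 x)⟩

instance levelStab_normal (m : ℕ) : (levelStab m).Normal := by
  induction m with
  | zero => rw [levelStab_zero]; infer_instance
  | succ m ih =>
    refine ⟨fun n hn g => ?_⟩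
    rw [mem_levelStab_succ] at hn ⊢
    refine ⟨by rw [rootAct_mul, rootAct_mul, hn.1, rootAct_inv, add_zero,
      CharTwo.add_self_eq_zero], fun x => ?_⟩
    rw [sectionAt_mul, sectionAt_mul, hn.1, sectionAt_inv, rootAct_inv, add_zero]
    exact ih.conj_mem _ (hn.2 _) _

/-- The map acting by `g` below `0` and by `h` below `1`. -/
def pairFun (g h : Vertex → Vertex) : Vertex → Vertex
  | [] => []
  | x :: w => if x = 0 then x :: g w else x :: h w

theorem pairFun_comp (g h g' h' : Vertex → Vertex) (w : Vertex) :
    pairFun g h (pairFun g' h' w) = pairFun (g ∘ g') (h ∘ h') w := by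
  cases w with
  | nil => rfl
  | cons x w => by_cases hx : x = 0 <;> simp [pairFun, hx]

theorem pairFun_id (w : Vertex) : pairFun id id w = w := by
  cases w <;> simp [pairFun]

/-- The automorphism `⟨g, h⟩`, acting by `g` below `0` and by `h` below `1`. -/
def pairAut (p : TreeAut × TreeAut) : TreeAut :=
  ⟨{ toFun := pairFun p.1.1 p.2.1
     invFun := pairFun p.1.1.symm p.2.1.symm
     left_inv := fun w => by
      rw [pairFun_comp, Equiv.symm_comp_self, Equiv.symm_comp_self, pairFun_id]
     right_inv := fun w => by
      rw [pairFun_comp, Equiv.self_comp_symm, Equiv.self_comp_symm, pairFun_id] },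
   fun w => by
    cases w with
    | nil => rfl
    | cons x w => by_cases hx : x = 0 <;> simp [pairFun, hx, p.1.2.1, p.2.2.1],
   fun u v => by
    cases u with
    | nil => simp [pairFun]
    | cons x u =>
      cases v with
      | nil => by_cases hx : x = 0 <;> simp [pairFun, hx]
      | cons y v =>
        by_cases hx : x = 0 <;> by_cases hy : y = 0
        · simp [pairFun, hx, hy, p.1.2.2]
        · simp [pairFun, hx, hy, List.cons_prefix_cons]; intro h; exact absurd h.symm hy
        · simp [pairFun, hx, hy, List.cons_prefix_cons]
        · simp [pairFun, hx, hy, List.cons_prefix_cons, p.2.2.2]⟩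

theorem pairAut_sections (p : TreeAut × TreeAut) :
    rootAct (pairAut p) = 0 ∧ sectionAt (pairAut p) 0 = p.1 ∧ sectionAt (pairAut p) 1 = p.2 := by
  have h0 := sectionAt_eq (g := pairAut p) (k := p.1) (x := 0) (y := 0) fun w => rfl
  have h1 := sectionAt_eq (g := pairAut p) (k := p.2) (x := 1) (y := 1) fun w => rfl
  exact ⟨by simpa using h0.1, h0.2, h1.2⟩

theorem pairAut_eq {g : TreeAut} (h : rootAct g = 0) :
    pairAut (sectionAt g 0, sectionAt g 1) = g := by
  obtain ⟨h0, h1, h2⟩ := pairAut_sections (sectionAt g 0, sectionAt g 1)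
  exact treeAut_ext (h0.trans h.symm) (zmod_two_forall.2 ⟨h1, h2⟩)

/-- `pairAut` as a homomorphism. -/
def pairHom : TreeAut × TreeAut →* TreeAut where
  toFun := pairAut
  map_one' := by
    obtain ⟨h0, h1, h2⟩ := pairAut_sections 1
    refine treeAut_ext (h0.trans rootAct_one.symm) (zmod_two_forall.2 ⟨?_, ?_⟩)
    · rw [h1, sectionAt_one]; rfl
    · rw [h2, sectionAt_one]; rfl
  map_mul' p q := by
    obtain ⟨h0, h1, h2⟩ := pairAut_sections (p * q)
    obtain ⟨p0, p1, p2⟩ := pairAut_sections p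
    obtain ⟨q0, q1, q2⟩ := pairAut_sections q
    refine treeAut_ext ?_ (zmod_two_forall.2 ⟨?_, ?_⟩)
    · rw [h0, rootAct_mul, p0, q0, add_zero]
    · rw [h1, sectionAt_mul, q0, add_zero, p1, q1]; rfl
    · rw [h2, sectionAt_mul, q0, add_zero, p2, q2]; rfl

theorem rootAct_pairHom (p : TreeAut × TreeAut) : rootAct (pairHom p) = 0 := (pairAut_sections p).1

theorem sectionAt_pairHom_zero (p : TreeAut × TreeAut) : sectionAt (pairHom p) 0 = p.1 :=
  (pairAut_sections p).2.1

theorem sectionAt_pairHom_one (p : TreeAut × TreeAut) : sectionAt (pairHom p) 1 = p.2 :=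
  (pairAut_sections p).2.2

theorem pairHom_injective : Function.Injective pairHom := fun p q h => by
  refine Prod.ext ?_ ?_
  · rw [← sectionAt_pairHom_zero p, h, sectionAt_pairHom_zero]
  · rw [← sectionAt_pairHom_one p, h, sectionAt_pairHom_one]

theorem range_pairHom : pairHom.range = levelStab 1 := by
  ext g
  rw [mem_levelStab_one]
  constructor
  · rintro ⟨p, rfl⟩
    exact rootAct_pairHom p
  · exact fun h => ⟨_, pairAut_eq h⟩

theorem pairHom_mem_levelStab {p : TreeAut × TreeAut} {m : ℕ} :
    pairHom p ∈ levelStab (m + 1) ↔ p.1 ∈ levelStab m ∧ p.2 ∈ levelStab m := by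
  rw [mem_levelStab_succ, zmod_two_forall, sectionAt_pairHom_zero, sectionAt_pairHom_one]
  simp [rootAct_pairHom]

/-! ### The generators of spinal groups as pairs. -/

/-- The power of the swap with exponent `c`. -/
def swapPow (c : ZMod 2) : TreeAut := if c = 0 then 1 else rootSwap

theorem swapPow_apply (c : ZMod 2) (w : Vertex) : (swapPow c).1 w = rootFun c w := by
  by_cases hc : c = 0
  · subst hc
    cases w <;> simp [swapPow, rootFun]
  · obtain rfl : c = 1 := by decide +revert
    rfl

theorem rootAct_rootSwap : rootAct rootSwap = 1 :=
  (sectionAt_eq (g := rootSwap) (k := 1) (x := 0) (y := 1) fun _ => rfl).1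

theorem sectionAt_rootSwap (x : ZMod 2) : sectionAt rootSwap x = 1 :=
  (sectionAt_eq (g := rootSwap) (k := 1) (y := x + 1) fun _ => rfl).2

theorem rootSwap_mul_self : rootSwap * rootSwap = 1 :=
  Subtype.ext (Equiv.ext (rootFun_invol 1))

theorem rootSwap_inv : rootSwap⁻¹ = rootSwap := inv_eq_of_mul_eq_one_left rootSwap_mul_self

theorem swapPow_zero : swapPow 0 = 1 := rfl

theorem rootAct_swapPow (c : ZMod 2) : rootAct (swapPow c) = c := by
  revert c
  exact zmod_two_forall.2 ⟨rfl, rootAct_rootSwap⟩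

theorem rootSwap_conj_pairHom (p : TreeAut × TreeAut) :
    rootSwap * pairHom p * rootSwap = pairHom p.swap := by
  refine treeAut_ext ?_ (zmod_two_forall.2 ⟨?_, ?_⟩)
  · simp only [rootAct_mul, rootAct_pairHom, rootAct_rootSwap]; rfl
  · simp [sectionAt_mul, rootAct_rootSwap, sectionAt_rootSwap, sectionAt_pairHom_zero,
      sectionAt_pairHom_one]
  · simp [sectionAt_mul, rootAct_rootSwap, sectionAt_rootSwap, sectionAt_pairHom_zero,
      sectionAt_pairHom_one, CharTwo.add_self_eq_zero]

theorem spineAut_eq_pairHom (c : ℕ → ZMod 2) :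
    spineAut c = pairHom (swapPow (c 0), spineAut fun i => c (i + 1)) := by
  apply Subtype.ext
  apply Equiv.ext
  rintro (_ | ⟨x, w⟩)
  · rfl
  · change (if x = 0 then x :: rootFun (c 0) w else x :: spineFun (fun i => c (i + 1)) w) =
      if x = 0 then x :: (swapPow (c 0)).1 w else x :: spineFun (fun i => c (i + 1)) w
    rw [swapPow_apply]

theorem rootAct_spineAut (c : ℕ → ZMod 2) : rootAct (spineAut c) = 0 := by
  rw [spineAut_eq_pairHom, rootAct_pairHom]

theorem rootFun_add (c d : ZMod 2) (w : Vertex) : rootFun (c + d) w = rootFun c (rootFun d w) := by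
  cases w with
  | nil => rfl
  | cons x w => simp only [rootFun]; congr 1; ring

theorem spineFun_add (c d : ℕ → ZMod 2) (w : Vertex) :
    spineFun (c + d) w = spineFun c (spineFun d w) := by
  induction w generalizing c d with
  | nil => rfl
  | cons x w ih =>
    by_cases hx : x = 0
    · simp [spineFun, hx, rootFun_add]
    · simp only [spineFun, hx, if_false]
      congr 1
      exact ih _ _

theorem spineAut_add (c d : ℕ → ZMod 2) : spineAut (c + d) = spineAut c * spineAut d :=
  Subtype.ext (Equiv.ext (spineFun_add c d))

theorem spineAut_mul_self (c : ℕ → ZMod 2) : spineAut c * spineAut c = 1 :=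
  Subtype.ext (Equiv.ext (spineFun_invol c))

/-- The term `c k` acts below the vertex 1^k 0, of depth k + 1, so it is first seen on level k + 2.
This is why level `m` sees exactly the terms of index less than `m - 1`. -/
theorem spineAut_mem_levelStab {c : ℕ → ZMod 2} {m : ℕ} (h : ∀ i < m - 1, c i = 0) :
    spineAut c ∈ levelStab m := by
  induction m generalizing c with
  | zero => rw [levelStab_zero]; trivial
  | succ m ih =>
    rw [spineAut_eq_pairHom, pairHom_mem_levelStab]
    refine ⟨?_, ih fun i hi => h (i + 1) (by omega)⟩
    cases m with
    | zero => rw [levelStab_zero]; trivial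
    | succ m =>
      have h0 : c 0 = 0 := h 0 (by omega)
      rw [h0, swapPow_zero]
      exact one_mem _

/-! ### Parity homomorphisms. -/

/-- The parity of the number of vertices of the given level at which a tree automorphism swaps
the two children. -/
def levelParity : ℕ → TreeAut → ZMod 2
  | 0, g => rootAct g
  | i + 1, g => levelParity i (sectionAt g 0) + levelParity i (sectionAt g 1)

/-- The factor `h` only permutes the vertices at which the swaps of `g` are counted, so the counts
add modulo 2. -/
theorem levelParity_mul (i : ℕ) (g h : TreeAut) :
    levelParity i (g * h) = levelParity i g + levelParity i h := by
  induction i generalizing g h with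
  | zero => exact rootAct_mul g h
  | succ i ih =>
    simp only [levelParity, sectionAt_mul, ih]
    generalize rootAct h = x
    revert x
    refine zmod_two_forall.2 ⟨?_, ?_⟩
    · simp only [add_zero]; ring
    · rw [zero_add, CharTwo.add_self_eq_zero]; ring

/-- `levelParity` as a homomorphism. -/
def levelParityHom (i : ℕ) : TreeAut →* Multiplicative (ZMod 2) :=
  MonoidHom.mk' (fun g => Multiplicative.ofAdd (levelParity i g)) fun g h => by
    rw [levelParity_mul]; rfl

theorem levelParity_one (i : ℕ) : levelParity i 1 = 0 := (levelParityHom i).map_one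

theorem levelParity_of_mem_levelStab {i j : ℕ} (h : i < j) {g : TreeAut} (hg : g ∈ levelStab j) :
    levelParity i g = 0 := by
  induction i generalizing j g with
  | zero => exact mem_levelStab_one.1 (levelStab_antitone h hg)
  | succ i ih =>
    obtain ⟨j, rfl⟩ := Nat.exists_eq_add_of_le' (Nat.lt_of_le_of_lt (Nat.zero_le _) h)
    rw [mem_levelStab_succ] at hg
    rw [levelParity, ih (by omega) (hg.2 0), ih (by omega) (hg.2 1), add_zero]

theorem levelParity_succ_rootSwap (i : ℕ) : levelParity (i + 1) rootSwap = 0 := by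
  rw [levelParity, sectionAt_rootSwap, sectionAt_rootSwap, levelParity_one, add_zero]

theorem levelParity_succ_swapPow (i : ℕ) (c : ZMod 2) : levelParity (i + 1) (swapPow c) = 0 := by
  revert c
  exact zmod_two_forall.2 ⟨levelParity_one _, levelParity_succ_rootSwap i⟩

/-- The possible swaps lie at the vertices 1^k 0, one on each level k + 1, so a parity isolates a
single term. -/
theorem levelParity_succ_spineAut (i : ℕ) (c : ℕ → ZMod 2) :
    levelParity (i + 1) (spineAut c) = c i := by
  induction i generalizing c with
  | zero =>
    rw [levelParity, spineAut_eq_pairHom, sectionAt_pairHom_zero, sectionAt_pairHom_one]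
    simp [levelParity, rootAct_swapPow, rootAct_spineAut]
  | succ i ih =>
    rw [levelParity, spineAut_eq_pairHom, sectionAt_pairHom_zero, sectionAt_pairHom_one,
      levelParity_succ_swapPow, ih, zero_add]

/-! ### Orders of the level quotients. -/

theorem cardMod_eq_relIndex (G : Subgroup TreeAut) (m : ℕ) :
    cardMod G m = (levelStab m).relIndex G := rfl

theorem cardMod_zero (G : Subgroup TreeAut) : cardMod G 0 = 1 := by
  rw [cardMod_eq_relIndex, levelStab_zero, Subgroup.relIndex_top_left]

theorem cardMod_one {G : Subgroup TreeAut} (h : rootSwap ∈ G) : cardMod G 1 = 2 := by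
  rw [cardMod_eq_relIndex, Subgroup.relIndex_eq_two_iff]
  refine ⟨rootSwap, h, fun g _ => ?_⟩
  rw [mem_levelStab_one, mem_levelStab_one, rootAct_mul, rootAct_rootSwap]
  generalize rootAct g = x
  revert x
  unfold Xor
  decide

/-- Counting a group of tree automorphisms on a level through the pairs of sections of its
elements: `f` is `pairHom`, or its restriction to a product of subgroups. -/
theorem cardMod_succ {G : Subgroup TreeAut} (h : rootSwap ∈ G) (m : ℕ) {Γ : Type*} [Group Γ]
    (f : Γ →* TreeAut) (hf : f.range ⊓ G = levelStab 1 ⊓ G) :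
    cardMod G (m + 1) = 2 * ((levelStab (m + 1)).comap f).relIndex (G.comap f) := by
  rw [Subgroup.relIndex_comap, Subgroup.map_comap_eq, hf]
  have h1 := Subgroup.relIndex_inf_mul_relIndex (levelStab (m + 1)) (levelStab 1) G
  rw [inf_eq_left.2 (levelStab_antitone (Nat.le_add_left 1 m)), ← cardMod_eq_relIndex G 1,
    cardMod_one h] at h1
  rw [cardMod_eq_relIndex, ← h1, mul_comm]

theorem comap_pairHom_levelStab (m : ℕ) :
    (levelStab (m + 1)).comap pairHom = (levelStab m).prod (levelStab m) := by
  ext p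
  exact pairHom_mem_levelStab

theorem cardMod_top (m : ℕ) : cardMod ⊤ m = 2 ^ (2 ^ m - 1) := by
  induction m with
  | zero => simp [cardMod_zero]
  | succ m ih =>
    rw [cardMod_succ (Subgroup.mem_top _) m pairHom (by rw [range_pairHom]), Subgroup.comap_top,
      comap_pairHom_levelStab, Subgroup.relIndex_top_right, Subgroup.index_prod,
      ← Subgroup.relIndex_top_right, ← cardMod_eq_relIndex, ih, ← pow_add, ← pow_succ']
    congr 1
    have : 1 ≤ 2 ^ m := Nat.one_le_two_pow
    rw [pow_succ]
    omega

instance levelStab_finiteIndex (m : ℕ) : (levelStab m).FiniteIndex :=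
  ⟨by rw [← Subgroup.relIndex_top_right, ← cardMod_eq_relIndex, cardMod_top]; positivity⟩

/-! ### Groups generated by two involutions. -/

section Dihedral

variable {D : Type*} [Group D] {x y : D}

theorem conj_mem_zpowers_mul (hx : x * x = 1) (hy : y * y = 1) {z : D}
    (hz : z ∈ Subgroup.zpowers (x * y)) : x * z * x ∈ Subgroup.zpowers (x * y) := by
  obtain ⟨k, rfl⟩ := Subgroup.mem_zpowers_iff.1 hz
  have hx' : x⁻¹ = x := inv_eq_of_mul_eq_one_left hx
  have hy' : y⁻¹ = y := inv_eq_of_mul_eq_one_left hy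
  have h1 : x * (x * y) ^ k * x = (x * (x * y) * x⁻¹) ^ k := by rw [conj_zpow, hx']
  have h2 : x * (x * y) * x⁻¹ = (x * y)⁻¹ := by
    rw [mul_inv_rev, hx', hy', ← mul_assoc, hx, one_mul]
  rw [h1, h2, inv_zpow]
  exact inv_mem (Subgroup.zpow_mem _ (Subgroup.mem_zpowers _) _)

/-- The order of a dihedral group generated by two involutions. -/
theorem card_closure_pair (hx : x * x = 1) (hy : y * y = 1)
    (h : x ∉ Subgroup.zpowers (x * y)) :
    Nat.card (Subgroup.closure {x, y}) = 2 * orderOf (x * y) := by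
  have hxC : x ∈ Subgroup.closure {x, y} := Subgroup.subset_closure (by simp)
  have hyC : y ∈ Subgroup.closure {x, y} := Subgroup.subset_closure (by simp)
  have hle : Subgroup.zpowers (x * y) ≤ Subgroup.closure {x, y} :=
    Subgroup.zpowers_le.2 (mul_mem hxC hyC)
  have hind : ∀ g ∈ Subgroup.closure {x, y},
      g * x ∈ Subgroup.zpowers (x * y) ∨ g ∈ Subgroup.zpowers (x * y) := by
    intro g hg
    induction hg using Subgroup.closure_induction with
    | mem g hg =>
      rcases hg with rfl | rfl
      · left; rw [hx]; exact one_mem _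
      · left
        have := inv_mem (Subgroup.mem_zpowers (x * g))
        rwa [mul_inv_rev, inv_eq_of_mul_eq_one_left hx, inv_eq_of_mul_eq_one_left hy] at this
    | one => right; exact one_mem _
    | mul g g' _ _ ih ih' =>
      rcases ih with ih | ih <;> rcases ih' with ih' | ih'
      · right
        have := mul_mem ih (conj_mem_zpowers_mul hx hy ih')
        have e : g * x * (x * (g' * x) * x) = g * (x * x) * g' * (x * x) := by group
        rwa [e, hx, mul_one, mul_one] at this
      · left
        have := mul_mem ih (conj_mem_zpowers_mul hx hy ih')
        have e : g * x * (x * g' * x) = g * (x * x) * g' * x := by group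
        rwa [e, hx, mul_one] at this
      · left
        rw [mul_assoc]; exact mul_mem ih ih'
      · right; exact mul_mem ih ih'
    | inv g _ ih =>
      rcases ih with ih | ih
      · left
        have := conj_mem_zpowers_mul hx hy (inv_mem ih)
        rwa [mul_inv_rev, mul_inv_cancel_left] at this
      · right; exact inv_mem ih
  have h2 : (Subgroup.zpowers (x * y)).relIndex (Subgroup.closure {x, y}) = 2 := by
    rw [Subgroup.relIndex_eq_two_iff]
    refine ⟨x, hxC, fun g hg => ?_⟩
    rw [xor_iff_or_and_not_and]
    refine ⟨hind g hg, fun hh => h ?_⟩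
    have := mul_mem (inv_mem hh.2) hh.1
    rwa [inv_mul_cancel_left] at this
  have h3 := Subgroup.relIndex_mul_relIndex ⊥ _ _ bot_le hle
  rw [Subgroup.relIndex_bot_left, Subgroup.relIndex_bot_left, h2, Nat.card_zpowers] at h3
  rw [← h3, mul_comm]

/-- If `x` were a power of `x * y`, it would commute with `x * y`, so `(x * y) ^ 2 = 1` and `x`
would be `1` or `x * y`. -/
theorem notMem_zpowers_mul (hx : x * x = 1) (hy : y * y = 1) (hx1 : x ≠ 1) (hy1 : y ≠ 1) :
    x ∉ Subgroup.zpowers (x * y) := by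
  intro h
  obtain ⟨k, hk⟩ := Subgroup.mem_zpowers_iff.1 h
  have hc : Commute x (x * y) := by
    have : Commute ((x * y) ^ k) (x * y) := (Commute.refl _).zpow_left k
    rwa [hk] at this
  have hxy : (x * y) * (x * y) = 1 := by
    rw [← mul_assoc, ← hc.eq, ← mul_assoc, hx, one_mul, hy]
  rcases Int.even_or_odd' k with ⟨m, rfl | rfl⟩
  · rw [zpow_mul, zpow_two, hxy, one_zpow] at hk
    exact hx1 hk.symm
  · rw [zpow_add, zpow_mul, zpow_two, hxy, one_zpow, one_mul, zpow_one] at hk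
    exact hy1 (mul_eq_left.1 hk)

end Dihedral

/-- Counting a subgroup `P` of `Γ × Γ` modulo `S × S` when `P` contains `N × N`. -/
theorem relIndex_prod_of_le {Γ : Type*} [Group Γ] (N S : Subgroup Γ) [N.Normal] [S.Normal]
    [S.FiniteIndex] {P : Subgroup (Γ × Γ)} (hP : N.prod N ≤ P) :
    (S.prod S).relIndex P = S.relIndex (N ⊔ S) ^ 2 *
      Nat.card (P.map ((QuotientGroup.mk' (N ⊔ S)).prodMap (QuotientGroup.mk' (N ⊔ S)))) := by
  set M := N ⊔ S with hM
  have hSM : S ≤ M := le_sup_right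
  have : M.FiniteIndex := Subgroup.finiteIndex_of_le hSM
  have : (S.prod S).Normal := Subgroup.prod_normal S S
  have hSMp : S.prod S ≤ M.prod M := Subgroup.prod_mono hSM hSM
  have h1 : (S.prod S).relIndex (M.prod M) = S.relIndex M ^ 2 := by
    have e1 := Subgroup.relIndex_mul_index hSMp
    rw [Subgroup.index_prod, Subgroup.index_prod, ← Subgroup.relIndex_mul_index hSM] at e1
    have hne : M.index * M.index ≠ 0 :=
      mul_ne_zero Subgroup.FiniteIndex.index_ne_zero Subgroup.FiniteIndex.index_ne_zero
    apply Nat.eq_of_mul_eq_mul_right (Nat.pos_of_ne_zero hne)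
    rw [e1]; ring
  -- The subgroup `N × N` of `P` already represents every class of `M × M` modulo `S × S`, so
  -- intersecting with `P` loses no index.
  have h2 : (M.prod M ⊓ P) ⊔ S.prod S = M.prod M := by
    refine le_antisymm (sup_le inf_le_left hSMp) ?_
    rintro ⟨m, m'⟩ ⟨hm, hm'⟩
    obtain ⟨n, hn, s, hs, rfl⟩ := Subgroup.mem_sup_of_normal_right.1 hm
    obtain ⟨n', hn', s', hs', rfl⟩ := Subgroup.mem_sup_of_normal_right.1 hm'
    have e : ((n * s, n' * s') : Γ × Γ) = (n, n') * (s, s') := rfl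
    rw [e]
    have hNM : N ≤ M := le_sup_left
    exact Subgroup.mul_mem_sup ⟨⟨hNM hn, hNM hn'⟩, hP ⟨hn, hn'⟩⟩ ⟨hs, hs'⟩
  have h3 : (S.prod S).relIndex (M.prod M ⊓ P) = S.relIndex M ^ 2 := by
    rw [← h1, ← h2, Subgroup.relIndex_sup_right, h2]
  have h4 := Subgroup.relIndex_inf_mul_relIndex (S.prod S) (M.prod M) P
  rw [inf_eq_left.2 hSMp, h3] at h4
  rw [← h4, ← Subgroup.relIndex_ker, MonoidHom.ker_prodMap, QuotientGroup.ker_mk']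

/-! ### Section pairs of a spinal group, its dihedral quotients, and the recursion for its order on
the levels. -/

section Spinal

variable {B : Type*} [AddCommGroup B] [Module (ZMod 2) B]

/-- The shifted sequence. -/
def shiftSeq (ω : ℕ → Module.Dual (ZMod 2) B) : ℕ → Module.Dual (ZMod 2) B := fun i => ω (i + 1)

variable (ω : ℕ → Module.Dual (ZMod 2) B)

/-- The generator `a` as an element of the spinal group. -/
def spinalSwap : spinalGroup ω := ⟨rootSwap, Subgroup.subset_closure (Or.inl rfl)⟩

/-- The generator given by `b` as an element of the spinal group. -/
def spinalGen (b : B) : spinalGroup ω :=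
  ⟨spineAut fun i => ω i b, Subgroup.subset_closure (Or.inr ⟨b, rfl⟩)⟩

theorem spinalSwap_mul_self : spinalSwap ω * spinalSwap ω = 1 := Subtype.ext rootSwap_mul_self

theorem spinalGen_mul_self (b : B) : spinalGen ω b * spinalGen ω b = 1 :=
  Subtype.ext (spineAut_mul_self _)

theorem spinalSwap_inv : (spinalSwap ω)⁻¹ = spinalSwap ω :=
  inv_eq_of_mul_eq_one_left (spinalSwap_mul_self ω)

theorem spinalGen_inv (b : B) : (spinalGen ω b)⁻¹ = spinalGen ω b :=
  inv_eq_of_mul_eq_one_left (spinalGen_mul_self ω b)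

theorem spinalGen_add (b b' : B) : spinalGen ω (b + b') = spinalGen ω b * spinalGen ω b' := by
  apply Subtype.ext
  change spineAut _ = spineAut _ * spineAut _
  rw [← spineAut_add]
  congr 1
  funext i
  simp

theorem rootSwap_mem_spinalGroup : rootSwap ∈ spinalGroup ω := (spinalSwap ω).2

/-- A power of the swap as an element of the spinal group. -/
def spinalSwapPow (c : ZMod 2) : spinalGroup ω :=
  ⟨swapPow c, by
    revert c
    exact zmod_two_forall.2 ⟨one_mem _, rootSwap_mem_spinalGroup ω⟩⟩

variable {ω}

theorem spinalGroup_closure_eq_top :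
    Subgroup.closure ({spinalSwap ω} ∪ Set.range (spinalGen ω)) = ⊤ := by
  refine eq_top_iff.2 fun g _ => ?_
  have h : spinalGroup ω ≤ (Subgroup.closure ({spinalSwap ω} ∪ Set.range (spinalGen ω))).map
      (spinalGroup ω).subtype := by
    refine (Subgroup.closure_le _).2 ?_
    rintro _ (rfl | ⟨b, rfl⟩)
    · exact ⟨spinalSwap ω, Subgroup.subset_closure (Or.inl rfl), rfl⟩
    · exact ⟨spinalGen ω b, Subgroup.subset_closure (Or.inr ⟨b, rfl⟩), rfl⟩
  obtain ⟨g', hg', e⟩ := h g.2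
  rwa [← Subtype.ext e]

/-- The generators are involutions, so an inclusion of the conjugate of `K` in `K` is already an
equality. -/
theorem spinal_normal {K : Subgroup (spinalGroup ω)}
    (ha : ∀ g ∈ K, spinalSwap ω * g * spinalSwap ω ∈ K)
    (hb : ∀ b, ∀ g ∈ K, spinalGen ω b * g * spinalGen ω b ∈ K) : K.Normal := by
  have key : ∀ t : spinalGroup ω, t * t = 1 → (∀ g ∈ K, t * g * t ∈ K) →
      t ∈ Subgroup.normalizer (K : Set (spinalGroup ω)) := by
    intro t ht h
    rw [Subgroup.mem_normalizer_iff, inv_eq_of_mul_eq_one_left ht]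
    refine fun g => ⟨h g, fun hg => ?_⟩
    have := h _ hg
    have e : t * (t * g * t) * t = (t * t) * g * (t * t) := by group
    rwa [e, ht, one_mul, mul_one] at this
  rw [← Subgroup.normalizer_eq_top_iff, eq_top_iff, ← spinalGroup_closure_eq_top,
    Subgroup.closure_le]
  rintro _ (rfl | ⟨b, rfl⟩)
  · exact key _ (spinalSwap_mul_self ω) ha
  · exact key _ (spinalGen_mul_self ω b) (hb b)

variable (ω) in
/-- The pairs of elements of the group of the shifted sequence, as tree automorphisms. -/
def spinalPair : spinalGroup (shiftSeq ω) × spinalGroup (shiftSeq ω) →* TreeAut :=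
  pairHom.comp ((spinalGroup (shiftSeq ω)).subtype.prodMap (spinalGroup (shiftSeq ω)).subtype)

theorem spinalPair_apply (p : spinalGroup (shiftSeq ω) × spinalGroup (shiftSeq ω)) :
    spinalPair ω p = pairHom (p.1.1, p.2.1) := rfl

theorem spinalPair_injective : Function.Injective (spinalPair ω) := by
  refine pairHom_injective.comp ?_
  rintro ⟨p, q⟩ ⟨p', q'⟩ h
  obtain ⟨h1, h2⟩ := Prod.mk.inj h
  exact Prod.ext (Subtype.ext h1) (Subtype.ext h2)

theorem rootAct_spinalPair (p : spinalGroup (shiftSeq ω) × spinalGroup (shiftSeq ω)) :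
    rootAct (spinalPair ω p) = 0 := rootAct_pairHom _

theorem rootSwap_conj_spinalPair (p : spinalGroup (shiftSeq ω) × spinalGroup (shiftSeq ω)) :
    rootSwap * spinalPair ω p * rootSwap = spinalPair ω p.swap := rootSwap_conj_pairHom _

theorem spinalPair_mem_levelStab {p : spinalGroup (shiftSeq ω) × spinalGroup (shiftSeq ω)}
    {m : ℕ} : spinalPair ω p ∈ levelStab (m + 1) ↔ p.1.1 ∈ levelStab m ∧ p.2.1 ∈ levelStab m :=
  pairHom_mem_levelStab

theorem spinalPair_gen (b : B) :
    spinalPair ω (spinalSwapPow _ (ω 0 b), spinalGen _ b) = (spinalGen ω b).1 :=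
  (spineAut_eq_pairHom fun i => ω i b).symm

theorem sectionAt_mem_spinalGroup {g : TreeAut} (hg : g ∈ spinalGroup ω) (x : ZMod 2) :
    sectionAt g x ∈ spinalGroup (shiftSeq ω) := by
  induction hg using Subgroup.closure_induction generalizing x with
  | mem g hg =>
    rcases hg with rfl | ⟨b, rfl⟩
    · rw [sectionAt_rootSwap]; exact one_mem _
    · revert x
      change ∀ x, sectionAt (spinalGen ω b).1 x ∈ _
      rw [← spinalPair_gen, spinalPair_apply]
      refine zmod_two_forall.2 ⟨?_, ?_⟩
      · rw [sectionAt_pairHom_zero]; exact Subtype.prop _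
      · rw [sectionAt_pairHom_one]; exact Subtype.prop _
  | one => rw [sectionAt_one]; exact one_mem _
  | mul g h _ _ ih ih' => rw [sectionAt_mul]; exact mul_mem (ih _) (ih' _)
  | inv g _ ih => rw [sectionAt_inv]; exact inv_mem (ih _)

theorem exists_spinalPair {g : TreeAut} (hg : g ∈ spinalGroup ω) (h : rootAct g = 0) :
    ∃ p, spinalPair ω p = g :=
  ⟨(⟨_, sectionAt_mem_spinalGroup hg 0⟩, ⟨_, sectionAt_mem_spinalGroup hg 1⟩), pairAut_eq h⟩

variable (ω) in
/-- The pairs of sections of the elements of the spinal group that fix the first level. -/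
def sectionPairs : Subgroup (spinalGroup (shiftSeq ω) × spinalGroup (shiftSeq ω)) :=
  (spinalGroup ω).comap (spinalPair ω)

theorem gen_mem_sectionPairs (b : B) :
    (spinalSwapPow _ (ω 0 b), spinalGen _ b) ∈ sectionPairs ω := by
  rw [sectionPairs, Subgroup.mem_comap, spinalPair_gen]
  exact Subtype.prop _

theorem swap_mem_sectionPairs {p : spinalGroup (shiftSeq ω) × spinalGroup (shiftSeq ω)}
    (hp : p ∈ sectionPairs ω) : p.swap ∈ sectionPairs ω := by
  rw [sectionPairs, Subgroup.mem_comap, ← rootSwap_conj_spinalPair]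
  exact mul_mem (mul_mem (rootSwap_mem_spinalGroup ω) hp) (rootSwap_mem_spinalGroup ω)

/-- The listed pairs are the sections of `b` and of its conjugate by `a`. They generate a group
stable under exchanging coordinates, so this group together with its translate by `a` is closed
under products and is all of G_ω; elements of the translate move the first level. -/
theorem sectionPairs_eq_closure : sectionPairs ω = Subgroup.closure
    ((Set.range fun b => (spinalSwapPow _ (ω 0 b), spinalGen _ b)) ∪
      Set.range fun b => (spinalGen _ b, spinalSwapPow _ (ω 0 b))) := by
  apply le_antisymm
  swap
  · refine (Subgroup.closure_le _).2 ?_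
    rintro _ (⟨b, rfl⟩ | ⟨b, rfl⟩)
    · exact gen_mem_sectionPairs b
    · exact swap_mem_sectionPairs (gen_mem_sectionPairs b)
  set E := Subgroup.closure
    ((Set.range fun b => (spinalSwapPow (shiftSeq ω) (ω 0 b), spinalGen (shiftSeq ω) b)) ∪
      Set.range fun b => (spinalGen (shiftSeq ω) b, spinalSwapPow (shiftSeq ω) (ω 0 b))) with hE
  have hswap : ∀ e ∈ E, e.swap ∈ E := by
    intro e he
    induction he using Subgroup.closure_induction with
    | mem e he =>
      rcases he with ⟨b, rfl⟩ | ⟨b, rfl⟩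
      · exact Subgroup.subset_closure (Or.inr ⟨b, rfl⟩)
      · exact Subgroup.subset_closure (Or.inl ⟨b, rfl⟩)
    | one => exact one_mem _
    | mul e e' _ _ ih ih' => exact mul_mem ih ih'
    | inv e _ ih => exact inv_mem ih
  have hmove : ∀ e, spinalPair ω e * rootSwap = rootSwap * spinalPair ω e.swap := fun e => by
    rw [← rootSwap_conj_spinalPair, ← mul_assoc, ← mul_assoc, rootSwap_mul_self, one_mul]
  have key : ∀ g ∈ spinalGroup ω, ∃ e ∈ E, g = spinalPair ω e ∨ g = rootSwap * spinalPair ω e := by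
    intro g hg
    induction hg using Subgroup.closure_induction with
    | mem g hg =>
      rcases hg with rfl | ⟨b, rfl⟩
      · exact ⟨1, one_mem _, Or.inr (by rw [map_one, mul_one])⟩
      · exact ⟨_, Subgroup.subset_closure (Or.inl ⟨b, rfl⟩), Or.inl (spinalPair_gen b).symm⟩
    | one => exact ⟨1, one_mem _, Or.inl (map_one _).symm⟩
    | mul g h _ _ ih ih' =>
      obtain ⟨e, he, h1⟩ := ih
      obtain ⟨e', he', h2⟩ := ih'
      rcases h1 with rfl | rfl <;> rcases h2 with rfl | rfl
      · exact ⟨e * e', mul_mem he he', Or.inl (map_mul _ _ _).symm⟩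
      · refine ⟨e.swap * e', mul_mem (hswap e he) he', Or.inr ?_⟩
        rw [← mul_assoc, hmove, mul_assoc, map_mul]
      · refine ⟨e * e', mul_mem he he', Or.inr ?_⟩
        rw [mul_assoc, map_mul]
      · refine ⟨e.swap * e', mul_mem (hswap e he) he', Or.inl ?_⟩
        rw [mul_assoc, ← mul_assoc (spinalPair ω e), hmove, mul_assoc, ← mul_assoc rootSwap,
          rootSwap_mul_self, one_mul, map_mul]
    | inv g _ ih =>
      obtain ⟨e, he, rfl | rfl⟩ := ih
      · exact ⟨e⁻¹, inv_mem he, Or.inl (map_inv _ _).symm⟩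
      · refine ⟨e⁻¹.swap, hswap _ (inv_mem he), Or.inr ?_⟩
        rw [mul_inv_rev, rootSwap_inv, ← map_inv, hmove]
  intro p hp
  obtain ⟨e, he, h | h⟩ := key _ hp
  · rwa [spinalPair_injective h]
  · have := rootAct_spinalPair p
    rw [h, rootAct_mul, rootAct_rootSwap, rootAct_spinalPair] at this
    exact absurd this (by decide)

variable (ω) in
/-- The normal closure in the spinal group of the elements of `B` in the kernel of `φ`. -/
def kernelClosure (φ : Module.Dual (ZMod 2) B) : Subgroup (spinalGroup ω) :=
  Subgroup.normalClosure {g | ∃ b, φ b = 0 ∧ spinalGen ω b = g}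

instance (φ : Module.Dual (ZMod 2) B) : (kernelClosure ω φ).Normal := Subgroup.normalClosure_normal

theorem spinalGen_mem_kernelClosure {φ : Module.Dual (ZMod 2) B} {b : B} (h : φ b = 0) :
    spinalGen ω b ∈ kernelClosure ω φ := Subgroup.subset_normalClosure ⟨b, h, rfl⟩

theorem kernelClosure_le {φ : Module.Dual (ZMod 2) B} {K : Subgroup (spinalGroup ω)} [K.Normal]
    (h : ∀ b, φ b = 0 → spinalGen ω b ∈ K) : kernelClosure ω φ ≤ K := by
  refine Subgroup.normalClosure_le_normal ?_
  rintro _ ⟨b, hb, rfl⟩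
  exact h b hb

theorem exists_eq_one_of_ne_zero {φ : Module.Dual (ZMod 2) B} (h : φ ≠ 0) : ∃ b, φ b = 1 := by
  by_contra hne
  push Not at hne
  refine h (LinearMap.ext fun b => ?_)
  have := hne b
  rw [LinearMap.zero_apply]
  generalize φ b = x at this
  decide +revert

/-- The `k` with (1, k) a section pair form a group normalized by all second coordinates of section
pairs. These include every `b`, and also `a`, through the pair (b₀, a) with ω₁(b₀) = 1; so the group
is normal. It contains ker ω₁, whose elements have pairs (1, b). -/
theorem kernelClosure_prod_le (h : ω 0 ≠ 0) :
    (kernelClosure (shiftSeq ω) (ω 0)).prod (kernelClosure (shiftSeq ω) (ω 0)) ≤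
      sectionPairs ω := by
  obtain ⟨b₀, hb₀⟩ := exists_eq_one_of_ne_zero h
  have key : kernelClosure (shiftSeq ω) (ω 0) ≤
      (sectionPairs ω).comap (MonoidHom.inr _ _) := by
    have : ((sectionPairs ω).comap (MonoidHom.inr _ _)).Normal := by
      refine spinal_normal (fun g hg => ?_) fun b g hg => ?_
      · have hm := swap_mem_sectionPairs (gen_mem_sectionPairs (ω := ω) b₀)
        rw [hb₀] at hm
        have := mul_mem (mul_mem hm hg) hm
        simp only [Prod.swap_prod_mk, MonoidHom.inr_apply, Prod.mk_mul_mk, mul_one,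
          spinalGen_mul_self] at this
        exact this
      · have hm := gen_mem_sectionPairs (ω := ω) b
        have := mul_mem (mul_mem hm hg) (inv_mem hm)
        simp only [MonoidHom.inr_apply, Prod.mk_mul_mk, mul_one, Prod.inv_mk,
          mul_inv_cancel, spinalGen_inv] at this
        exact this
    refine kernelClosure_le fun b hb => ?_
    have hm := gen_mem_sectionPairs (ω := ω) b
    rw [hb] at hm
    exact hm
  rintro ⟨n, n'⟩ ⟨hn, hn'⟩
  have := mul_mem (swap_mem_sectionPairs (key hn)) (key hn')
  simpa using this

variable (ω) in
/-- The normal closure of the kernel of `φ`, together with the fixator of the `j`-th level. -/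
def kernelMod (φ : Module.Dual (ZMod 2) B) (j : ℕ) : Subgroup (spinalGroup ω) :=
  kernelClosure ω φ ⊔ (levelStab j).subgroupOf (spinalGroup ω)

instance (φ : Module.Dual (ZMod 2) B) (j : ℕ) : (kernelMod ω φ j).Normal := by
  unfold kernelMod; infer_instance

/-- The rotation `a b` of the dihedral quotient of the spinal group. -/
noncomputable def dihedralRotation (ω : ℕ → Module.Dual (ZMod 2) B) (φ : Module.Dual (ZMod 2) B) (j : ℕ)
    (b : B) : spinalGroup ω ⧸ kernelMod ω φ j :=
  QuotientGroup.mk (spinalSwap ω) * QuotientGroup.mk (spinalGen ω b)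

theorem mk_spinalGen_eq_one {φ : Module.Dual (ZMod 2) B} {j : ℕ} {b : B} (h : φ b = 0) :
    (QuotientGroup.mk (spinalGen ω b) : spinalGroup ω ⧸ kernelMod ω φ j) = 1 :=
  (QuotientGroup.eq_one_iff _).2 (Subgroup.mem_sup_left (spinalGen_mem_kernelClosure h))

/-- Only the value of `φ` survives in the quotient: `B` has at most one non-trivial image there,
which makes the quotient dihedral. -/
theorem mk_spinalGen_congr {φ : Module.Dual (ZMod 2) B} {j : ℕ} {b b' : B} (h : φ b = φ b') :
    (QuotientGroup.mk (spinalGen ω b) : spinalGroup ω ⧸ kernelMod ω φ j) =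
      QuotientGroup.mk (spinalGen ω b') := by
  rw [QuotientGroup.eq, spinalGen_inv, ← spinalGen_add]
  refine Subgroup.mem_sup_left (spinalGen_mem_kernelClosure ?_)
  rw [map_add, h, CharTwo.add_self_eq_zero]

theorem dihedralRotation_congr {φ : Module.Dual (ZMod 2) B} {j : ℕ} {b b' : B} (h : φ b = φ b') :
    dihedralRotation ω φ j b = dihedralRotation ω φ j b' := by
  rw [dihedralRotation, dihedralRotation, mk_spinalGen_congr h]

theorem kernelMod_le_ker (φ : Module.Dual (ZMod 2) B) {j : ℕ} (hj : 1 ≤ j) :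
    kernelMod ω φ j ≤ (rootActHom.comp (spinalGroup ω).subtype).ker := by
  refine sup_le (kernelClosure_le fun b _ => ?_) fun g hg => ?_
  · exact rootAct_spineAut fun i => ω i b
  · exact mem_levelStab_one.1 (levelStab_antitone hj hg)

/-- The action on the first level as a homomorphism of the dihedral quotient. -/
noncomputable def quotientRootAct (ω : ℕ → Module.Dual (ZMod 2) B) (φ : Module.Dual (ZMod 2) B)
    {j : ℕ} (hj : 1 ≤ j) : spinalGroup ω ⧸ kernelMod ω φ j →* Multiplicative (ZMod 2) :=
  QuotientGroup.lift _ (rootActHom.comp (spinalGroup ω).subtype) (kernelMod_le_ker φ hj)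

theorem quotientRootAct_swap (φ : Module.Dual (ZMod 2) B) {j : ℕ} (hj : 1 ≤ j) :
    quotientRootAct ω φ hj (QuotientGroup.mk (spinalSwap ω)) = Multiplicative.ofAdd 1 :=
  congrArg Multiplicative.ofAdd rootAct_rootSwap

theorem quotientRootAct_gen (φ : Module.Dual (ZMod 2) B) {j : ℕ} (hj : 1 ≤ j) (b : B) :
    quotientRootAct ω φ hj (QuotientGroup.mk (spinalGen ω b)) = 1 :=
  congrArg Multiplicative.ofAdd (rootAct_spineAut fun i => ω i b)

theorem mk_spinalSwap_ne_one (φ : Module.Dual (ZMod 2) B) {j : ℕ} (hj : 1 ≤ j) :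
    (QuotientGroup.mk (spinalSwap ω) : spinalGroup ω ⧸ kernelMod ω φ j) ≠ 1 := by
  intro h
  have := quotientRootAct_swap (ω := ω) φ hj
  rw [h, map_one] at this
  exact absurd this (by decide)

theorem mk_spinalSwap_mul_self (φ : Module.Dual (ZMod 2) B) (j : ℕ) :
    (QuotientGroup.mk (spinalSwap ω) : spinalGroup ω ⧸ kernelMod ω φ j) *
      QuotientGroup.mk (spinalSwap ω) = 1 := by
  rw [← QuotientGroup.mk_mul, spinalSwap_mul_self, QuotientGroup.mk_one]

theorem mk_spinalGen_mul_self (φ : Module.Dual (ZMod 2) B) (j : ℕ) (b : B) :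
    (QuotientGroup.mk (spinalGen ω b) : spinalGroup ω ⧸ kernelMod ω φ j) *
      QuotientGroup.mk (spinalGen ω b) = 1 := by
  rw [← QuotientGroup.mk_mul, spinalGen_mul_self, QuotientGroup.mk_one]

theorem closure_quotient_eq_top {φ : Module.Dual (ZMod 2) B} {b : B} (hb : φ b = 1) (j : ℕ) :
    Subgroup.closure {(QuotientGroup.mk (spinalSwap ω) : spinalGroup ω ⧸ kernelMod ω φ j),
      QuotientGroup.mk (spinalGen ω b)} = ⊤ := by
  have h : (Subgroup.closure ({spinalSwap ω} ∪ Set.range (spinalGen ω))).map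
      (QuotientGroup.mk' (kernelMod ω φ j)) = ⊤ := by
    rw [spinalGroup_closure_eq_top, ← MonoidHom.range_eq_map, MonoidHom.range_eq_top]
    exact QuotientGroup.mk'_surjective _
  rw [eq_top_iff, ← h, MonoidHom.map_closure, Subgroup.closure_le]
  rintro _ ⟨_, rfl | ⟨b', rfl⟩, rfl⟩
  · exact Subgroup.subset_closure (Or.inl rfl)
  · change (QuotientGroup.mk (spinalGen ω b') : spinalGroup ω ⧸ kernelMod ω φ j) ∈ _
    have h01 : φ b' = 0 ∨ φ b' = 1 := by
      generalize φ b' = x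
      decide +revert
    rcases h01 with h0 | h1
    · rw [mk_spinalGen_eq_one h0]; exact one_mem _
    · rw [mk_spinalGen_congr (h1.trans hb.symm)]
      exact Subgroup.subset_closure (Or.inr rfl)

/-- In the degenerate case the rotation is the image of `a`, which still moves the first level. Its
order 2 lets `card_map_sectionPairs` cover this case without change. -/
theorem orderOf_dihedralRotation_of_eq_one {φ : Module.Dual (ZMod 2) B} {j : ℕ} (hj : 1 ≤ j) {b : B}
    (h : (QuotientGroup.mk (spinalGen ω b) : spinalGroup ω ⧸ kernelMod ω φ j) = 1) :
    orderOf (dihedralRotation ω φ j b) = 2 := by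
  rw [dihedralRotation, h, mul_one]
  exact orderOf_eq_prime (by rw [pow_two, mk_spinalSwap_mul_self]) (mk_spinalSwap_ne_one φ hj)

theorem kernelMod_index_of_eq_one {φ : Module.Dual (ZMod 2) B} {j : ℕ} (hj : 1 ≤ j) {b : B}
    (hb : φ b = 1)
    (h : (QuotientGroup.mk (spinalGen ω b) : spinalGroup ω ⧸ kernelMod ω φ j) = 1) :
    (kernelMod ω φ j).index = 2 := by
  have h1 := closure_quotient_eq_top (ω := ω) hb j
  rw [Set.pair_comm, h, Subgroup.closure_insert_one, ← Subgroup.zpowers_eq_closure] at h1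
  have h2 := orderOf_dihedralRotation_of_eq_one hj h
  rw [dihedralRotation, h, mul_one] at h2
  rw [Subgroup.index, ← Subgroup.card_top, ← h1, Nat.card_zpowers, h2]

theorem kernelMod_index_of_ne_one {φ : Module.Dual (ZMod 2) B} {j : ℕ} (hj : 1 ≤ j) {b : B}
    (hb : φ b = 1)
    (h : (QuotientGroup.mk (spinalGen ω b) : spinalGroup ω ⧸ kernelMod ω φ j) ≠ 1) :
    (kernelMod ω φ j).index = 2 * orderOf (dihedralRotation ω φ j b) := by
  rw [Subgroup.index, ← Subgroup.card_top, ← closure_quotient_eq_top (ω := ω) hb j,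
    card_closure_pair (mk_spinalSwap_mul_self φ j) (mk_spinalGen_mul_self φ j b)
    (notMem_zpowers_mul (mk_spinalSwap_mul_self φ j) (mk_spinalGen_mul_self φ j b)
      (mk_spinalSwap_ne_one φ hj) h)]
  rfl

/-- The image is generated by the involutions (x, y) and (y, x), with product (xy, (xy)⁻¹); the
order of this product is that of xy. -/
theorem card_map_sectionPairs {b : B} (hb : ω 0 b = 1) {j : ℕ} (hj : 1 ≤ j) :
    Nat.card ((sectionPairs ω).map
      ((QuotientGroup.mk' (kernelMod (shiftSeq ω) (ω 0) j)).prodMap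
        (QuotientGroup.mk' (kernelMod (shiftSeq ω) (ω 0) j)))) =
      2 * orderOf (dihedralRotation (shiftSeq ω) (ω 0) j b) := by
  set x : spinalGroup (shiftSeq ω) ⧸ kernelMod (shiftSeq ω) (ω 0) j :=
    QuotientGroup.mk (spinalSwap (shiftSeq ω)) with hx
  set y : spinalGroup (shiftSeq ω) ⧸ kernelMod (shiftSeq ω) (ω 0) j :=
    QuotientGroup.mk (spinalGen (shiftSeq ω) b) with hy
  have hxx : x * x = 1 := mk_spinalSwap_mul_self _ j
  have hyy : y * y = 1 := mk_spinalGen_mul_self _ j b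
  have hc : (sectionPairs ω).map
      ((QuotientGroup.mk' (kernelMod (shiftSeq ω) (ω 0) j)).prodMap
        (QuotientGroup.mk' (kernelMod (shiftSeq ω) (ω 0) j))) =
      Subgroup.closure {(x, y), (y, x)} := by
    have hgen : ∀ b', (ω 0 b' = 0 ∧
          (QuotientGroup.mk (spinalGen (shiftSeq ω) b') : spinalGroup (shiftSeq ω) ⧸
            kernelMod (shiftSeq ω) (ω 0) j) = 1) ∨ (ω 0 b' = 1 ∧
          (QuotientGroup.mk (spinalGen (shiftSeq ω) b') : spinalGroup (shiftSeq ω) ⧸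
            kernelMod (shiftSeq ω) (ω 0) j) = y) := by
      intro b'
      have h01 : ω 0 b' = 0 ∨ ω 0 b' = 1 := by
        generalize ω 0 b' = x
        decide +revert
      rcases h01 with h0 | h1
      · exact Or.inl ⟨h0, mk_spinalGen_eq_one h0⟩
      · exact Or.inr ⟨h1, mk_spinalGen_congr (h1.trans hb.symm)⟩
    rw [sectionPairs_eq_closure, MonoidHom.map_closure]
    apply le_antisymm
    · refine (Subgroup.closure_le _).2 ?_
      rintro _ ⟨_, ⟨b', rfl⟩ | ⟨b', rfl⟩, rfl⟩
      · rcases hgen b' with ⟨h0, h1⟩ | ⟨h0, h1⟩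
        · have : ((QuotientGroup.mk (spinalSwapPow (shiftSeq ω) (ω 0 b')),
            QuotientGroup.mk (spinalGen (shiftSeq ω) b')) :
            (spinalGroup (shiftSeq ω) ⧸ kernelMod (shiftSeq ω) (ω 0) j) ×
            (spinalGroup (shiftSeq ω) ⧸ kernelMod (shiftSeq ω) (ω 0) j)) = 1 := by
            rw [h0, h1]; rfl
          exact Set.mem_of_eq_of_mem this (one_mem (Subgroup.closure _))
        · have : ((QuotientGroup.mk (spinalSwapPow (shiftSeq ω) (ω 0 b')),
            QuotientGroup.mk (spinalGen (shiftSeq ω) b')) :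
            (spinalGroup (shiftSeq ω) ⧸ kernelMod (shiftSeq ω) (ω 0) j) ×
            (spinalGroup (shiftSeq ω) ⧸ kernelMod (shiftSeq ω) (ω 0) j)) = (x, y) := by
            rw [h0, h1]; rfl
          exact Set.mem_of_eq_of_mem this <| Subgroup.subset_closure (Or.inl rfl)
      · rcases hgen b' with ⟨h0, h1⟩ | ⟨h0, h1⟩
        · have : ((QuotientGroup.mk (spinalGen (shiftSeq ω) b'),
            QuotientGroup.mk (spinalSwapPow (shiftSeq ω) (ω 0 b'))) :
            (spinalGroup (shiftSeq ω) ⧸ kernelMod (shiftSeq ω) (ω 0) j) ×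
            (spinalGroup (shiftSeq ω) ⧸ kernelMod (shiftSeq ω) (ω 0) j)) = 1 := by
            rw [h0, h1]; rfl
          exact Set.mem_of_eq_of_mem this (one_mem (Subgroup.closure _))
        · have : ((QuotientGroup.mk (spinalGen (shiftSeq ω) b'),
            QuotientGroup.mk (spinalSwapPow (shiftSeq ω) (ω 0 b'))) :
            (spinalGroup (shiftSeq ω) ⧸ kernelMod (shiftSeq ω) (ω 0) j) ×
            (spinalGroup (shiftSeq ω) ⧸ kernelMod (shiftSeq ω) (ω 0) j)) = (y, x) := by
            rw [h0, h1]; rfl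
          exact Set.mem_of_eq_of_mem this <| Subgroup.subset_closure (Or.inr rfl)
    · refine Subgroup.closure_mono ?_
      rintro _ (rfl | rfl)
      · exact ⟨_, Or.inl ⟨b, rfl⟩, by beta_reduce; rw [hb]; rfl⟩
      · exact ⟨_, Or.inr ⟨b, rfl⟩, by beta_reduce; rw [hb]; rfl⟩
  rw [hc, card_closure_pair (x := (x, y)) (y := (y, x)) (Prod.ext hxx hyy) (Prod.ext hyy hxx)]
  · have hinv : y * x = (x * y)⁻¹ := by
      rw [mul_inv_rev, inv_eq_of_mul_eq_one_left hxx, inv_eq_of_mul_eq_one_left hyy]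
    rw [Prod.mk_mul_mk, Prod.orderOf_mk, hinv, orderOf_inv, Nat.lcm_self]
    rfl
  · intro hmem
    obtain ⟨k, hk⟩ := Subgroup.mem_zpowers_iff.1 hmem
    rw [Prod.mk_mul_mk] at hk
    -- Both coordinates of a power of (xy, yx) act in the same way on the first level, whereas `x`
    -- swaps it and `y` fixes it.
    have h1 := congrArg (fun p => quotientRootAct (shiftSeq ω) (ω 0) hj p.1) hk
    have h2 := congrArg (fun p => quotientRootAct (shiftSeq ω) (ω 0) hj p.2) hk
    simp only [Prod.pow_fst, Prod.pow_snd, map_zpow, map_mul, hx, hy, quotientRootAct_swap,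
      quotientRootAct_gen, mul_one, one_mul] at h1 h2
    exact absurd (h1.symm.trans h2) (by decide)

/-- The factors come from the action on the first level, from `N × N`, and from the dihedral image
of the section pairs. -/
theorem cardMod_spinalGroup_succ {b : B} (hb : ω 0 b = 1) {j : ℕ} (hj : 1 ≤ j) :
    cardMod (spinalGroup ω) (j + 1) =
      2 * (((levelStab j).subgroupOf (spinalGroup (shiftSeq ω))).relIndex
        (kernelMod (shiftSeq ω) (ω 0) j) ^ 2 *
        (2 * orderOf (dihedralRotation (shiftSeq ω) (ω 0) j b))) := by
  have h0 : ω 0 ≠ 0 := by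
    intro h
    rw [h, LinearMap.zero_apply] at hb
    exact absurd hb (by decide)
  have hrel := relIndex_prod_of_le (kernelClosure (shiftSeq ω) (ω 0))
    ((levelStab j).subgroupOf (spinalGroup (shiftSeq ω))) (kernelClosure_prod_le h0)
  change _ = ((levelStab j).subgroupOf (spinalGroup (shiftSeq ω))).relIndex
    (kernelMod (shiftSeq ω) (ω 0) j) ^ 2 * Nat.card ((sectionPairs ω).map
      ((QuotientGroup.mk' (kernelMod (shiftSeq ω) (ω 0) j)).prodMap
        (QuotientGroup.mk' (kernelMod (shiftSeq ω) (ω 0) j)))) at hrel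
  rw [card_map_sectionPairs hb hj] at hrel
  rw [← hrel, cardMod_succ (rootSwap_mem_spinalGroup ω) j (spinalPair ω)]
  · congr 2
    ext p
    exact spinalPair_mem_levelStab
  · ext g
    constructor
    · rintro ⟨⟨p, rfl⟩, hg⟩
      exact ⟨mem_levelStab_one.2 (rootAct_spinalPair p), hg⟩
    · rintro ⟨h, hg⟩
      exact ⟨exists_spinalPair hg (mem_levelStab_one.1 h), hg⟩

theorem cardMod_eq_relIndex_mul_index (φ : Module.Dual (ZMod 2) B) (j : ℕ) :
    cardMod (spinalGroup ω) j =
      ((levelStab j).subgroupOf (spinalGroup ω)).relIndex (kernelMod ω φ j) *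
        (kernelMod ω φ j).index :=
  (Subgroup.relIndex_mul_index le_sup_right).symm

theorem cardMod_spinalGroup_succ_of_eq_one {b : B} (hb : ω 0 b = 1) {j : ℕ} (hj : 1 ≤ j)
    (h : (QuotientGroup.mk (spinalGen (shiftSeq ω) b) :
      spinalGroup (shiftSeq ω) ⧸ kernelMod (shiftSeq ω) (ω 0) j) = 1) :
    cardMod (spinalGroup ω) (j + 1) = 2 * cardMod (spinalGroup (shiftSeq ω)) j ^ 2 := by
  rw [cardMod_spinalGroup_succ hb hj, cardMod_eq_relIndex_mul_index (ω 0) j,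
    kernelMod_index_of_eq_one hj hb h, orderOf_dihedralRotation_of_eq_one hj h]
  ring

/-- With rotation order q, the square of |Γ mod j| carries the factor (2q)², while |G_ω mod (j+1)|
carries 2 · 2q: the quotient is q. -/
theorem cardMod_spinalGroup_succ_of_ne_one {b : B} (hb : ω 0 b = 1) {j : ℕ} (hj : 1 ≤ j)
    (h : (QuotientGroup.mk (spinalGen (shiftSeq ω) b) :
      spinalGroup (shiftSeq ω) ⧸ kernelMod (shiftSeq ω) (ω 0) j) ≠ 1) :
    cardMod (spinalGroup ω) (j + 1) * orderOf (dihedralRotation (shiftSeq ω) (ω 0) j b) =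
      cardMod (spinalGroup (shiftSeq ω)) j ^ 2 := by
  rw [cardMod_spinalGroup_succ hb hj, cardMod_eq_relIndex_mul_index (ω 0) j,
    kernelMod_index_of_ne_one hj hb h]
  ring

end Spinal

/-! ### The order of the rotation in the dihedral quotients. -/

section Spinal

variable {B : Type*} [AddCommGroup B] [Module (ZMod 2) B] {ω : ℕ → Module.Dual (ZMod 2) B}

theorem zmod_two_eq_zero_or_one : ∀ x : ZMod 2, x = 0 ∨ x = 1 := by decide

/-- By duality some `c` is killed by all visible letters and not by `φ`. It fixes level `j`, and it
has the same image as `b`. -/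
theorem mk_spinalGen_eq_one_of_notMem_span [FiniteDimensional (ZMod 2) B]
    {φ : Module.Dual (ZMod 2) B} {j : ℕ}
    (h : φ ∉ Submodule.span (ZMod 2) (ω '' {i | i < j - 1})) {b : B} (hb : φ b = 1) :
    (QuotientGroup.mk (spinalGen ω b) : spinalGroup ω ⧸ kernelMod ω φ j) = 1 := by
  rw [← Subspace.dualCoannihilator_dualAnnihilator_eq
    (W := Submodule.span (ZMod 2) (ω '' {i | i < j - 1})), Submodule.mem_dualAnnihilator] at h
  push Not at h
  obtain ⟨c, hc, hφ⟩ := h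
  have hφ1 : φ c = 1 := (zmod_two_eq_zero_or_one _).resolve_left hφ
  rw [mk_spinalGen_congr (hb.trans hφ1.symm), QuotientGroup.eq_one_iff]
  refine Subgroup.mem_sup_right (spineAut_mem_levelStab fun i hi => ?_)
  exact (Submodule.mem_dualCoannihilator _).1 hc _ (Submodule.subset_span ⟨i, hi, rfl⟩)

/-- The homomorphisms on pairs of tree automorphisms that detect the functionals in the span of
the first letters of `ω`. -/
theorem exists_hom_of_mem_span {φ : Module.Dual (ZMod 2) B} {j : ℕ}
    (h : φ ∈ Submodule.span (ZMod 2) (ω '' {i | i < j})) :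
    ∃ f : TreeAut × TreeAut →* Multiplicative (ZMod 2),
      (∀ b, f (swapPow (ω 0 b), spineAut fun i => ω (i + 1) b) = Multiplicative.ofAdd (φ b)) ∧
      (∀ b, f (spineAut fun i => ω (i + 1) b, swapPow (ω 0 b)) = 1) ∧
      ∀ p : TreeAut × TreeAut, p.1 ∈ levelStab j → p.2 ∈ levelStab j → f p = 1 := by
  induction h using Submodule.span_induction with
  | mem φ hφ =>
    obtain ⟨i, hi, rfl⟩ := hφ
    rcases i with _ | i
    · refine ⟨rootActHom.comp (MonoidHom.fst _ _), fun b => ?_, fun b => ?_, fun p h1 _ => ?_⟩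
      · exact congrArg Multiplicative.ofAdd (rootAct_swapPow _)
      · exact congrArg Multiplicative.ofAdd (rootAct_spineAut fun i => ω (i + 1) b)
      · exact congrArg Multiplicative.ofAdd (mem_levelStab_one.1 (levelStab_antitone hi h1))
    · refine ⟨(levelParityHom (i + 1)).comp (MonoidHom.snd _ _), fun b => ?_, fun b => ?_,
        fun p _ h2 => ?_⟩
      · exact congrArg Multiplicative.ofAdd (levelParity_succ_spineAut i fun i => ω (i + 1) b)
      · exact congrArg Multiplicative.ofAdd (levelParity_succ_swapPow i _)
      · exact congrArg Multiplicative.ofAdd (levelParity_of_mem_levelStab hi h2)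
  | zero => exact ⟨1, fun _ => rfl, fun _ => rfl, fun _ _ _ => rfl⟩
  | add φ ψ _ _ ih ih' =>
    obtain ⟨f, h1, h2, h3⟩ := ih
    obtain ⟨g, k1, k2, k3⟩ := ih'
    refine ⟨f * g, fun b => ?_, fun b => ?_, fun p hp hp' => ?_⟩
    · rw [MonoidHom.mul_apply, h1, k1]; rfl
    · rw [MonoidHom.mul_apply, h2, k2, mul_one]
    · rw [MonoidHom.mul_apply, h3 p hp hp', k3 p hp hp', mul_one]
  | smul c φ _ ih =>
    rcases zmod_two_eq_zero_or_one c with rfl | rfl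
    · exact ⟨1, fun _ => by rw [zero_smul]; rfl, fun _ => rfl, fun _ _ _ => rfl⟩
    · rwa [one_smul]

/-- The rotation swaps the first level. Evenness is needed to recover its order from that of its
square. -/
theorem orderOf_dihedralRotation_dvd (φ : Module.Dual (ZMod 2) B) {j : ℕ} (hj : 1 ≤ j) (b : B) :
    2 ∣ orderOf (dihedralRotation ω φ j b) := by
  have h := orderOf_map_dvd (quotientRootAct ω φ hj) (dihedralRotation ω φ j b)
  rw [dihedralRotation, map_mul, quotientRootAct_swap, quotientRootAct_gen, mul_one] at h
  rwa [orderOf_eq_prime (p := 2) (by decide) (by decide)] at h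

/-- The square of `a b`, as a pair of sections. -/
theorem spinalPair_sq (b : B) :
    spinalPair ω ((spinalSwapPow _ (ω 0 b), spinalGen _ b).swap *
      (spinalSwapPow _ (ω 0 b), spinalGen _ b)) = ((spinalSwap ω * spinalGen ω b) ^ 2).1 := by
  rw [map_mul, ← rootSwap_conj_spinalPair, spinalPair_gen, pow_two]
  simp only [mul_assoc]
  rfl

/-- The elements of the spinal group whose pair of sections lies in `K`. -/
def pairPreimage (ω : ℕ → Module.Dual (ZMod 2) B)
    (K : Subgroup (spinalGroup (shiftSeq ω) × spinalGroup (shiftSeq ω))) :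
    Subgroup (spinalGroup ω) :=
  (K.map (spinalPair ω)).subgroupOf (spinalGroup ω)

theorem pairPreimage_normal
    {K : Subgroup (spinalGroup (shiftSeq ω) × spinalGroup (shiftSeq ω))}
    (hswap : ∀ p ∈ K, p.swap ∈ K)
    (hgen : ∀ b, ∀ p ∈ K, (spinalSwapPow _ (ω 0 b), spinalGen _ b) * p *
      (spinalSwapPow _ (ω 0 b), spinalGen _ b)⁻¹ ∈ K) : (pairPreimage ω K).Normal := by
  refine spinal_normal ?_ ?_
  · rintro g ⟨p, hp, hpg⟩
    refine ⟨p.swap, hswap p hp, ?_⟩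
    rw [← rootSwap_conj_spinalPair, hpg]
    rfl
  · rintro b g ⟨p, hp, hpg⟩
    refine ⟨_, hgen b p hp, ?_⟩
    rw [map_mul, map_mul, map_inv, hpg, spinalPair_gen]
    change (spinalGen ω b * g * (spinalGen ω b)⁻¹).1 = _
    rw [spinalGen_inv]
    rfl

/-- The way to bound `kernelMod` from above: a group of section pairs stable under the generators of
G_ω has a normal preimage, so only the kernel of `φ` and the fixator of the level need checking. -/
theorem kernelMod_le_pairPreimage {φ : Module.Dual (ZMod 2) B} {j : ℕ}
    {K : Subgroup (spinalGroup (shiftSeq ω) × spinalGroup (shiftSeq ω))}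
    (hswap : ∀ p ∈ K, p.swap ∈ K)
    (hgen : ∀ b, ∀ p ∈ K, (spinalSwapPow _ (ω 0 b), spinalGen _ b) * p *
      (spinalSwapPow _ (ω 0 b), spinalGen _ b)⁻¹ ∈ K)
    (hker : ∀ b, φ b = 0 → (spinalSwapPow _ (ω 0 b), spinalGen _ b) ∈ K)
    (hstab : ∀ p : spinalGroup (shiftSeq ω) × spinalGroup (shiftSeq ω),
      p.1.1 ∈ levelStab j → p.2.1 ∈ levelStab j → p ∈ K) :
    kernelMod ω φ (j + 1) ≤ pairPreimage ω K := by
  have := pairPreimage_normal hswap hgen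
  refine sup_le (kernelClosure_le fun b hb => ⟨_, hker b hb, spinalPair_gen b⟩) ?_
  intro g hg
  have hg' : g.1 ∈ levelStab (j + 1) := hg
  obtain ⟨p, hp⟩ := exists_spinalPair g.2 (mem_levelStab_succ.1 hg').1
  rw [← hp, spinalPair_mem_levelStab] at hg'
  exact ⟨p, hstab p hg'.1 hg'.2, hp⟩

/-- A homomorphism to ℤ/2ℤ on pairs, seen on level `j`, takes the value φ(b) on the pair of `b` and
vanishes on the exchanged pair. So it is 1 on the pair of (ab)². -/
theorem dihedralRotation_sq_ne_one {φ : Module.Dual (ZMod 2) B} {j : ℕ}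
    (h : φ ∈ Submodule.span (ZMod 2) (ω '' {i | i < j})) {b : B} (hb : φ b = 1) :
    dihedralRotation ω φ (j + 1) b ^ 2 ≠ 1 := by
  obtain ⟨f, h1, h2, h3⟩ := exists_hom_of_mem_span h
  set F : spinalGroup (shiftSeq ω) × spinalGroup (shiftSeq ω) →* Multiplicative (ZMod 2) :=
    f.comp ((spinalGroup (shiftSeq ω)).subtype.prodMap (spinalGroup (shiftSeq ω)).subtype) with hF
  have F1 : ∀ b, F (spinalSwapPow _ (ω 0 b), spinalGen _ b) = Multiplicative.ofAdd (φ b) := h1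
  have F2 : ∀ b, F (spinalGen _ b, spinalSwapPow _ (ω 0 b)) = 1 := h2
  have hle : kernelMod ω φ (j + 1) ≤
      -- Intersecting with the exchanged kernel makes the group stable under conjugation by `a`.
      pairPreimage ω (F.ker ⊓ (F.comp (MulEquiv.prodComm.toMonoidHom)).ker) := by
    refine kernelMod_le_pairPreimage (fun p hp => ⟨hp.2, hp.1⟩) (fun b p hp => ?_)
      (fun b hb => ?_) fun p hp hp' => ⟨h3 _ hp hp', h3 _ hp' hp⟩
    · have hn : (F.ker ⊓ (F.comp (MulEquiv.prodComm.toMonoidHom)).ker).Normal := inferInstance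
      exact hn.conj_mem p hp _
    · refine ⟨?_, F2 b⟩
      exact (F1 b).trans (congrArg Multiplicative.ofAdd hb)
  intro hsq
  have hmem : (spinalSwap ω * spinalGen ω b) ^ 2 ∈ kernelMod ω φ (j + 1) :=
    (QuotientGroup.eq_one_iff _).1 hsq
  obtain ⟨p, hp, hpe⟩ := hle hmem
  replace hpe := hpe.trans (spinalPair_sq b).symm
  have h4 : F p = 1 := hp.1
  rw [spinalPair_injective hpe, map_mul, Prod.swap_prod_mk, F1, F2, hb] at h4
  exact absurd h4 (by decide)

theorem exists_eq_one_eq_zero {φ ψ : Module.Dual (ZMod 2) B} (h : φ ≠ ψ) (hφ : φ ≠ 0) :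
    ∃ b, φ b = 1 ∧ ψ b = 0 := by
  obtain ⟨b, hb⟩ := exists_eq_one_of_ne_zero hφ
  obtain ⟨c, hc⟩ := exists_eq_one_of_ne_zero (sub_ne_zero.2 h)
  rw [LinearMap.sub_apply] at hc
  rcases zmod_two_eq_zero_or_one (ψ b) with h0 | h0
  · exact ⟨b, hb, h0⟩
  rcases zmod_two_eq_zero_or_one (φ c) with h1 | h1 <;>
    rcases zmod_two_eq_zero_or_one (ψ c) with h2 | h2 <;> rw [h1, h2] at hc
  · exact absurd hc (by decide)
  · exact ⟨b + c, by rw [map_add, hb, h1]; decide, by rw [map_add, h0, h2]; decide⟩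
  · exact ⟨c, h1, h2⟩
  · exact absurd hc (by decide)

/-- The generator can be replaced by some `c` with the same value of `φ` that is killed by the first
letter. Then (ac)² has the pair of sections (c, c), an involution. -/
theorem dihedralRotation_pow_four {φ : Module.Dual (ZMod 2) B} {j : ℕ} (h : φ ≠ ω 0) {b : B}
    (hb : φ b = 1) : dihedralRotation ω φ j b ^ 4 = 1 := by
  have hφ : φ ≠ 0 := by
    rintro rfl
    exact absurd hb (by simp)
  obtain ⟨c, hc, hc'⟩ := exists_eq_one_eq_zero h hφ
  rw [dihedralRotation_congr (hb.trans hc.symm)]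
  have h1 : (spinalSwap ω * spinalGen ω c) ^ 4 = 1 := by
    apply Subtype.ext
    rw [show 4 = 2 * 2 from rfl, pow_mul, Subgroup.coe_pow, ← spinalPair_sq, ← map_pow, hc']
    have : ((spinalSwapPow (shiftSeq ω) 0, spinalGen (shiftSeq ω) c).swap *
        (spinalSwapPow _ 0, spinalGen _ c)) ^ 2 = 1 := by
      have h0 : spinalSwapPow (shiftSeq ω) 0 = 1 := rfl
      rw [h0, Prod.swap_prod_mk, Prod.mk_mul_mk, mul_one, one_mul, pow_two, Prod.mk_mul_mk,
        spinalGen_mul_self]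
      rfl
    rw [this, map_one]
    rfl
  exact congrArg (QuotientGroup.mk' (kernelMod ω φ j)) h1

theorem orderOf_dihedralRotation_of_ne {φ : Module.Dual (ZMod 2) B} {j : ℕ}
    (h : φ ∈ Submodule.span (ZMod 2) (ω '' {i | i < j - 1})) (hne : φ ≠ ω 0) {b : B}
    (hb : φ b = 1) : orderOf (dihedralRotation ω φ j b) = 4 := by
  rcases j with _ | j
  -- On level 0 the truncated `j - 1` leaves the empty span, which would force `φ = 0`.
  · simp only [zero_tsub, not_lt_zero, Set.ofPred_false, Set.image_empty,
      Submodule.span_empty, Submodule.mem_bot] at h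
    rw [h] at hb
    exact absurd hb (by simp)
  · exact orderOf_eq_prime_pow (p := 2) (n := 1) (dihedralRotation_sq_ne_one h hb)
      (dihedralRotation_pow_four hne hb)

/-- When `φ` is the first letter, the kernel of `φ` consists of pairs (1, b), and its normal closure
is the full product of the corresponding closures one level below. -/
theorem mem_kernelMod_of_pair {φ : Module.Dual (ZMod 2) B} (h0 : ω 0 = φ) (hφ : φ ≠ 0) {j : ℕ}
    {g : spinalGroup ω} {p : spinalGroup (shiftSeq ω) × spinalGroup (shiftSeq ω)}
    (hp : spinalPair ω p = g.1) :
    g ∈ kernelMod ω φ (j + 1) ↔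
      p.1 ∈ kernelMod (shiftSeq ω) φ j ∧ p.2 ∈ kernelMod (shiftSeq ω) φ j := by
  subst h0
  constructor
  · intro hg
    have hle : kernelMod ω (ω 0) (j + 1) ≤ pairPreimage ω
        ((kernelMod (shiftSeq ω) (ω 0) j).prod (kernelMod (shiftSeq ω) (ω 0) j)) := by
      refine kernelMod_le_pairPreimage (fun p hp => ⟨hp.2, hp.1⟩) (fun b p hp => ?_)
        (fun b hb => ⟨?_, ?_⟩) fun p hp hp' =>
          ⟨Subgroup.mem_sup_right hp, Subgroup.mem_sup_right hp'⟩
      · exact (Subgroup.prod_normal _ _).conj_mem p hp _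
      · rw [hb]; exact one_mem _
      · exact Subgroup.mem_sup_left (spinalGen_mem_kernelClosure hb)
    obtain ⟨q, hq, hqg⟩ := hle hg
    rwa [← spinalPair_injective (hqg.trans hp.symm)]
  · rintro ⟨h1, h2⟩
    obtain ⟨b₀, hb₀⟩ := exists_eq_one_of_ne_zero hφ
    -- The `k` for which (1, k) lies in the normal closure form a normal subgroup: conjugation by
    -- `b` acts on `k` as `b`, and conjugation by `a b₀ a`, with pair (b₀, a), acts on it as `a`.
    have key : kernelClosure (shiftSeq ω) (ω 0) ≤
        ((kernelClosure ω (ω 0)).map (spinalGroup ω).subtype).comap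
          ((spinalPair ω).comp (MonoidHom.inr _ _)) := by
      have : (((kernelClosure ω (ω 0)).map (spinalGroup ω).subtype).comap
          ((spinalPair ω).comp (MonoidHom.inr _ _))).Normal := by
        have conj : ∀ (t : spinalGroup ω) (q : spinalGroup (shiftSeq ω) × _) (k : _),
            spinalPair ω q = t.1 → (∃ x ∈ kernelClosure ω (ω 0), x.1 = spinalPair ω (1, k)) →
            ∃ x ∈ kernelClosure ω (ω 0), x.1 = spinalPair ω (1, q.2 * k * q.2⁻¹) := by
          rintro t q k hq ⟨x, hx, hxk⟩
          refine ⟨t * x * t⁻¹, Subgroup.normalClosure_normal.conj_mem x hx t, ?_⟩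
          have e : ((1, q.2 * k * q.2⁻¹) : spinalGroup (shiftSeq ω) × spinalGroup (shiftSeq ω)) =
              q * (1, k) * q⁻¹ := by
            refine Prod.ext ?_ rfl
            simp
          rw [e, map_mul, map_mul, map_inv, hq, ← hxk]
          rfl
        refine spinal_normal (fun k hk => ?_) fun b k hk => ?_
        · have := conj (spinalSwap ω * spinalGen ω b₀ * spinalSwap ω)
            ((spinalSwapPow _ (ω 0 b₀), spinalGen _ b₀).swap) k (by
              rw [← rootSwap_conj_spinalPair, spinalPair_gen]; rfl) hk
          rw [hb₀] at this
          have e : (spinalSwapPow (shiftSeq ω) 1, spinalGen (shiftSeq ω) b₀).swap.2 =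
            spinalSwap (shiftSeq ω) := rfl
          rw [e, spinalSwap_inv] at this
          exact this
        · have := conj (spinalGen ω b) _ k (spinalPair_gen b) hk
          rw [spinalGen_inv] at this
          exact this
      refine kernelClosure_le fun b hb => ⟨spinalGen ω b, spinalGen_mem_kernelClosure hb, ?_⟩
      have h := spinalPair_gen (ω := ω) b
      rw [hb] at h
      exact h.symm
    obtain ⟨n, hn, s, hs, e1⟩ := Subgroup.mem_sup_of_normal_right.1 h1
    obtain ⟨n', hn', s', hs', e2⟩ := Subgroup.mem_sup_of_normal_right.1 h2
    obtain ⟨x, hx, hxn⟩ := key hn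
    obtain ⟨x', hx', hxn'⟩ := key hn'
    have hx2 : spinalSwap ω * x * spinalSwap ω ∈ kernelClosure ω (ω 0) := by
      have := Subgroup.normalClosure_normal.conj_mem x hx (spinalSwap ω)
      rwa [spinalSwap_inv] at this
    have hy : (spinalSwap ω * x * spinalSwap ω).1 = spinalPair ω (n, 1) := by
      have := rootSwap_conj_spinalPair (ω := ω) (1, n)
      rw [Prod.swap_prod_mk] at this
      rw [← this]
      change rootSwap * x.1 * rootSwap = _
      rw [show x.1 = spinalPair ω (1, n) from hxn]
    set y := spinalSwap ω * x * spinalSwap ω * x' with hydef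
    have hyN : y ∈ kernelClosure ω (ω 0) := mul_mem hx2 hx'
    have hgy : (y⁻¹ * g).1 = spinalPair ω (s, s') := by
      have e3 : y.1 = spinalPair ω (n, n') := by
        have : ((n, n') : spinalGroup (shiftSeq ω) × spinalGroup (shiftSeq ω)) =
            (n, 1) * (1, n') := by simp
        rw [this, map_mul, ← hy]
        change _ * x'.1 = _
        rw [show x'.1 = spinalPair ω (1, n') from hxn']
      have e4 : p = (n, n') * (s, s') := Prod.ext e1.symm e2.symm
      change y.1⁻¹ * g.1 = _
      rw [← hp, e4, map_mul, e3, inv_mul_cancel_left]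
    have hgyS : y⁻¹ * g ∈ (levelStab (j + 1)).subgroupOf (spinalGroup ω) := by
      change (y⁻¹ * g).1 ∈ levelStab (j + 1)
      rw [hgy, spinalPair_mem_levelStab]
      exact ⟨hs, hs'⟩
    have := Subgroup.mul_mem_sup hyN hgyS
    rwa [mul_inv_cancel_left] at this

/-- The pair of (ab)² is ((ab)⁻¹, ab), so by `mem_kernelMod_of_pair` the square has the order of the
rotation for the shifted sequence. -/
theorem orderOf_dihedralRotation_succ {φ : Module.Dual (ZMod 2) B} (h0 : ω 0 = φ) {j : ℕ}
    {b : B} (hb : φ b = 1) :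
    orderOf (dihedralRotation ω φ (j + 1) b) =
      2 * orderOf (dihedralRotation (shiftSeq ω) φ j b) := by
  have hφ : φ ≠ 0 := by
    rintro rfl
    exact absurd hb (by simp)
  have hsq : orderOf (dihedralRotation ω φ (j + 1) b ^ 2) =
      orderOf (dihedralRotation (shiftSeq ω) φ j b) := by
    rw [orderOf_eq_orderOf_iff]
    intro n
    have hn := spinalPair_sq (ω := ω) b
    rw [h0, hb] at hn
    have hpow : spinalPair ω (((spinalSwapPow _ 1, spinalGen _ b).swap *
      (spinalSwapPow _ 1, spinalGen _ b)) ^ n) =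
        (((spinalSwap ω * spinalGen ω b) ^ 2) ^ n).1 := by
      rw [map_pow, hn]
      rfl
    have h1 := mem_kernelMod_of_pair h0 hφ (j := j) hpow
    have h2 : dihedralRotation ω φ (j + 1) b ^ 2 = QuotientGroup.mk
      ((spinalSwap ω * spinalGen ω b) ^ 2) := rfl
    rw [h2, ← QuotientGroup.mk_pow, QuotientGroup.eq_one_iff, h1]
    have e2 : ((spinalSwapPow (shiftSeq ω) 1, spinalGen (shiftSeq ω) b).swap *
      (spinalSwapPow _ 1, spinalGen _ b)) = (((spinalSwap _ * spinalGen _ b)⁻¹),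
        spinalSwap _ * spinalGen _ b) := by
      rw [mul_inv_rev, spinalSwap_inv, spinalGen_inv]
      rfl
    rw [e2, Prod.pow_mk, inv_pow, inv_mem_iff, and_self, ← QuotientGroup.eq_one_iff,
      QuotientGroup.mk_pow]
    rfl
  rw [← hsq]
  have hd := orderOf_dihedralRotation_dvd (ω := ω) φ (Nat.le_add_left 1 j) b
  rw [orderOf_pow' _ two_ne_zero, Nat.gcd_eq_right hd, Nat.mul_div_cancel' hd]

theorem orderOf_dihedralRotation_add {φ : Module.Dual (ZMod 2) B} {r : ℕ}
    (h : ∀ i < r, ω i = φ) (j : ℕ) {b : B} (hb : φ b = 1) :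
    orderOf (dihedralRotation ω φ (r + j) b) =
      2 ^ r * orderOf (dihedralRotation (fun i => ω (i + r)) φ j b) := by
  induction r generalizing ω with
  | zero => rw [zero_add, pow_zero, one_mul]; rfl
  | succ r ih =>
    rw [show r + 1 + j = r + j + 1 by ring, orderOf_dihedralRotation_succ (h 0 (by omega)) hb,
      ih (ω := shiftSeq ω) fun i hi => h (i + 1) (by omega), pow_succ',
      mul_assoc]
    rfl

/-- A crude bound, used only to keep the logarithmic error of one step linear in the level. -/
theorem orderOf_dihedralRotation_pos_le [FiniteDimensional (ZMod 2) B]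
    {φ : Module.Dual (ZMod 2) B} {j : ℕ} (hj : 1 ≤ j) {b : B} (hb : φ b = 1) :
    1 ≤ orderOf (dihedralRotation ω φ j b) ∧ orderOf (dihedralRotation ω φ j b) ≤ 2 ^ j := by
  induction j, hj using Nat.le_induction generalizing ω with
  | base =>
    rw [orderOf_dihedralRotation_of_eq_one le_rfl
      (mk_spinalGen_eq_one_of_notMem_span (fun h => ?_) hb)]
    · norm_num
    · simp only [tsub_self, not_lt_zero, Set.ofPred_false, Set.image_empty,
        Submodule.span_empty, Submodule.mem_bot] at h
      rw [h] at hb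
      exact absurd hb (by simp)
  | succ j hj ih =>
    by_cases h0 : ω 0 = φ
    · rw [orderOf_dihedralRotation_succ h0 hb, pow_succ']
      have := ih (ω := shiftSeq ω)
      omega
    · have h4 : 2 ^ 2 ≤ 2 ^ (j + 1) := Nat.pow_le_pow_right (by norm_num) (by omega)
      by_cases hs : φ ∈ Submodule.span (ZMod 2) (ω '' {i | i < j + 1 - 1})
      · rw [orderOf_dihedralRotation_of_ne hs (Ne.symm h0) hb]
        omega
      · rw [orderOf_dihedralRotation_of_eq_one (by omega)
          (mk_spinalGen_eq_one_of_notMem_span hs hb)]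
        omega

/-! ### The recursion for the logarithm of the order. -/

/-- The logarithm in base `2` of the order of `G_ω mod m`. -/
noncomputable def logCard (ω : ℕ → Module.Dual (ZMod 2) B) (m : ℕ) : ℝ :=
  Real.logb 2 (cardMod (spinalGroup ω) m)

theorem cardMod_pos (G : Subgroup TreeAut) (m : ℕ) : 0 < cardMod G m := by
  rw [cardMod_eq_relIndex]
  exact Nat.pos_of_ne_zero Subgroup.FiniteIndex.index_ne_zero

theorem logCard_one : logCard ω 1 = 1 := by
  rw [logCard, cardMod_one (rootSwap_mem_spinalGroup ω)]
  simp

theorem logCard_succ_of_eq_one {b : B} (hb : ω 0 b = 1) {j : ℕ} (hj : 1 ≤ j)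
    (h : (QuotientGroup.mk (spinalGen (shiftSeq ω) b) :
      spinalGroup (shiftSeq ω) ⧸ kernelMod (shiftSeq ω) (ω 0) j) = 1) :
    logCard ω (j + 1) = 2 * logCard (shiftSeq ω) j + 1 := by
  have hpos : (cardMod (spinalGroup (shiftSeq ω)) j : ℝ) ≠ 0 := by
    exact_mod_cast (cardMod_pos _ j).ne'
  rw [logCard, cardMod_spinalGroup_succ_of_eq_one hb hj h, Nat.cast_mul, Nat.cast_pow,
    Real.logb_mul (by norm_num) (pow_ne_zero 2 hpos), Real.logb_pow, Nat.cast_ofNat,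
    Real.logb_self_eq_one (by norm_num), add_comm]
  rfl

theorem logCard_succ_of_ne_one {b : B} (hb : ω 0 b = 1) {j : ℕ} (hj : 1 ≤ j)
    (h : (QuotientGroup.mk (spinalGen (shiftSeq ω) b) :
      spinalGroup (shiftSeq ω) ⧸ kernelMod (shiftSeq ω) (ω 0) j) ≠ 1) :
    logCard ω (j + 1) = 2 * logCard (shiftSeq ω) j -
      Real.logb 2 (orderOf (dihedralRotation (shiftSeq ω) (ω 0) j b)) := by
  have h1 := cardMod_spinalGroup_succ_of_ne_one hb hj h
  have hpos : (cardMod (spinalGroup ω) (j + 1) : ℝ) ≠ 0 := by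
    exact_mod_cast (cardMod_pos _ _).ne'
  have hpos' : (orderOf (dihedralRotation (shiftSeq ω) (ω 0) j b) : ℝ) ≠ 0 := by
    intro h0
    rw [Nat.cast_eq_zero] at h0
    rw [h0, mul_zero] at h1
    exact absurd h1.symm (pow_ne_zero 2 (cardMod_pos _ _).ne')
  have h2 := congrArg (fun n : ℕ => Real.logb 2 n) h1
  simp only [Nat.cast_mul, Nat.cast_pow, Real.logb_pow, Nat.cast_ofNat] at h2
  rw [Real.logb_mul hpos hpos'] at h2
  rw [logCard, logCard]
  linarith

theorem logCard_succ_of_orderOf {b : B} (hb : ω 0 b = 1) {j e : ℕ} (hj : 1 ≤ j) (he : 2 ≤ e)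
    (h : orderOf (dihedralRotation (shiftSeq ω) (ω 0) j b) = 2 ^ e) :
    logCard ω (j + 1) = 2 * logCard (shiftSeq ω) j - e := by
  rw [logCard_succ_of_ne_one hb hj, h]
  · rw [Nat.cast_pow, Nat.cast_ofNat, Real.logb_pow, Real.logb_self_eq_one (by norm_num), mul_one]
  · intro h1
    rw [orderOf_dihedralRotation_of_eq_one hj h1] at h
    have : 2 ^ 2 ≤ 2 ^ e := Nat.pow_le_pow_right (by norm_num) he
    omega

/-- Each of the `r` repetitions doubles the order of the rotation; the first different letter then
leaves order 4, hence 2^(r+2). -/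
theorem logCard_of_repeat_of_mem_span (h0 : ω 0 ≠ 0) {r j : ℕ} (hj : 1 ≤ j)
    (hrep : ∀ i < r, ω (i + 1) = ω 0) (hne : ω (r + 1) ≠ ω 0)
    (h : ω 0 ∈ Submodule.span (ZMod 2) ((fun i => ω (i + r + 1)) '' {i | i < j - 1})) :
    logCard ω (r + j + 1) = 2 * logCard (shiftSeq ω) (r + j) - (r + 2) := by
  obtain ⟨b, hb⟩ := exists_eq_one_of_ne_zero h0
  rw [logCard_succ_of_orderOf (e := r + 2) hb (by omega) (by omega)]
  · push_cast; ring
  · have h2 := orderOf_dihedralRotation_of_ne h (by simpa using hne.symm) hb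
    rw [orderOf_dihedralRotation_add (ω := shiftSeq ω) hrep j hb, pow_add,
      show 2 ^ 2 = 4 from rfl, ← h2]
    rfl

variable [FiniteDimensional (ZMod 2) B]

theorem logCard_succ_of_notMem_span (h0 : ω 0 ≠ 0) {j : ℕ} (hj : 1 ≤ j)
    (h : ω 0 ∉ Submodule.span (ZMod 2) ((fun i => ω (i + 1)) '' {i | i < j - 1})) :
    logCard ω (j + 1) = 2 * logCard (shiftSeq ω) j + 1 := by
  obtain ⟨b, hb⟩ := exists_eq_one_of_ne_zero h0
  exact logCard_succ_of_eq_one hb hj (mk_spinalGen_eq_one_of_notMem_span h hb)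

/-- As in the dependent case, but the doublings end at the degenerate order 2. With `1 ≤ r` the
total order 2^(r+1) is at least 4, so the quotient itself is not degenerate. -/
theorem logCard_of_repeat_of_notMem_span (h0 : ω 0 ≠ 0) {r j : ℕ} (hr : 1 ≤ r) (hj : 1 ≤ j)
    (hrep : ∀ i < r, ω (i + 1) = ω 0)
    (h : ω 0 ∉ Submodule.span (ZMod 2) ((fun i => ω (i + r + 1)) '' {i | i < j - 1})) :
    logCard ω (r + j + 1) = 2 * logCard (shiftSeq ω) (r + j) - (r + 1) := by
  obtain ⟨b, hb⟩ := exists_eq_one_of_ne_zero h0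
  rw [logCard_succ_of_orderOf (e := r + 1) hb (by omega) (by omega)]
  · push_cast; ring
  · have h2 := orderOf_dihedralRotation_of_eq_one hj (mk_spinalGen_eq_one_of_notMem_span h hb)
    rw [orderOf_dihedralRotation_add (ω := shiftSeq ω) hrep j hb, pow_succ, ← h2]
    rfl

theorem logCard_succ_bounds (h0 : ω 0 ≠ 0) {j : ℕ} (hj : 1 ≤ j) :
    2 * logCard (shiftSeq ω) j - j ≤ logCard ω (j + 1) ∧
      logCard ω (j + 1) ≤ 2 * logCard (shiftSeq ω) j + 1 := by
  obtain ⟨b, hb⟩ := exists_eq_one_of_ne_zero h0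
  by_cases h : (QuotientGroup.mk (spinalGen (shiftSeq ω) b) :
      spinalGroup (shiftSeq ω) ⧸ kernelMod (shiftSeq ω) (ω 0) j) = 1
  · rw [logCard_succ_of_eq_one hb hj h]
    have : (0 : ℝ) ≤ j := Nat.cast_nonneg j
    constructor <;> linarith
  · rw [logCard_succ_of_ne_one hb hj h]
    obtain ⟨h1, h2⟩ := orderOf_dihedralRotation_pos_le (ω := shiftSeq ω) hj hb
    have h1' : (1 : ℝ) ≤ orderOf (dihedralRotation (shiftSeq ω) (ω 0) j b) := by exact_mod_cast h1
    have h3 := Real.logb_nonneg (b := 2) (by norm_num) h1'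
    have h4 : Real.logb 2 (orderOf (dihedralRotation (shiftSeq ω) (ω 0) j b)) ≤ j := by
      rw [Real.logb_le_iff_le_rpow (by norm_num) (by linarith), Real.rpow_natCast]
      exact_mod_cast h2
    constructor <;> linarith

end Spinal

/-! ### Lower limits along perturbed sequences and subsequences. -/

open Topology in
theorem liminf_eq_of_tendsto_sub {u v : ℕ → ℝ} {c C : ℝ} (hc : ∀ᶠ n in atTop, c ≤ v n)
    (hC : ∀ᶠ n in atTop, v n ≤ C) (h : Tendsto (fun n => u n - v n) atTop (𝓝 0)) :
    liminf u atTop = liminf v atTop := by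
  have hvb : IsBoundedUnder (· ≥ ·) atTop v := ⟨c, by simpa using hc⟩
  have hvB : IsBoundedUnder (· ≤ ·) atTop v := ⟨C, by simpa using hC⟩
  have key : ∀ {v d w : ℕ → ℝ}, IsBoundedUnder (· ≥ ·) atTop v → IsBoundedUnder (· ≤ ·) atTop v →
      Tendsto d atTop (𝓝 0) → w = v + d → liminf v atTop ≤ liminf w atTop := by
    rintro v d w h1 h2 hd rfl
    have := le_liminf_add (f := atTop) (u := v) (v := d) h1 h2
      hd.isBoundedUnder_ge hd.isBoundedUnder_le.isCoboundedUnder_ge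
    rwa [hd.liminf_eq, add_zero] at this
  have hu : u = v + fun n => u n - v n := by funext n; simp
  have hv : v = u + fun n => -(u n - v n) := by funext n; simp
  have h' : Tendsto (fun n => -(u n - v n)) atTop (𝓝 0) := by simpa using h.neg
  have hub : IsBoundedUnder (· ≥ ·) atTop u := by
    rw [hu]; exact isBoundedUnder_ge_add hvb h.isBoundedUnder_ge
  have huB : IsBoundedUnder (· ≤ ·) atTop u := by
    rw [hu]; exact isBoundedUnder_le_add hvB h.isBoundedUnder_le
  exact le_antisymm (key hub huB h' hv) (key hvb hvB h hu)

/-- A liminf computed along a subsequence that bounds the sequence from below. -/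
theorem liminf_eq_liminf_comp {v : ℕ → ℝ} {c C : ℝ} (hc : ∀ᶠ n in atTop, c ≤ v n)
    (hC : ∀ᶠ n in atTop, v n ≤ C) {τ κ : ℕ → ℕ} (hτ : Tendsto τ atTop atTop)
    (hκ : Tendsto κ atTop atTop) (h : ∀ᶠ n in atTop, v (τ (κ n)) ≤ v n) :
    liminf v atTop = liminf (v ∘ τ) atTop := by
  have hvb : IsBoundedUnder (· ≥ ·) atTop v := ⟨c, by simpa using hc⟩
  have hvB : IsBoundedUnder (· ≤ ·) atTop v := ⟨C, by simpa using hC⟩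
  have hb : ∀ {σ : ℕ → ℕ}, Tendsto σ atTop atTop → IsBoundedUnder (· ≥ ·) atTop (v ∘ σ) :=
    fun hσ => ⟨c, by simpa using hσ.eventually hc⟩
  have hB : ∀ {σ : ℕ → ℕ}, Tendsto σ atTop atTop → IsBoundedUnder (· ≤ ·) atTop (v ∘ σ) :=
    fun hσ => ⟨C, by simpa using hσ.eventually hC⟩
  apply le_antisymm
  · exact hτ.liminf_le_liminf_comp (hB hτ).isCoboundedUnder_ge hvb
  · refine (hκ.liminf_le_liminf_comp (u := v ∘ τ) (hB (hτ.comp hκ)).isCoboundedUnder_ge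
      (hb hτ)).trans ?_
    exact liminf_le_liminf h (hb (hτ.comp hκ)) hvB.isCoboundedUnder_ge

/-! ### The dimension up to linear errors, and the recurrent case. -/

section Spinal

variable {B : Type*} [AddCommGroup B] [Module (ZMod 2) B] {ω : ℕ → Module.Dual (ZMod 2) B}

theorem hausdorffDim_spinalGroup (ω : ℕ → Module.Dual (ZMod 2) B) :
    hausdorffDim (spinalGroup ω) = liminf (fun m => logCard ω m / (2 ^ m - 1)) atTop := by
  rw [hausdorffDim]
  congr 1
  funext m
  rw [cardMod_top, logCard, Real.logb, Nat.cast_pow, Real.log_pow,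
    Nat.cast_sub Nat.one_le_two_pow, div_div]
  push_cast
  rw [mul_comm (Real.log 2)]

open Topology in
/-- The Hausdorff dimension is determined by `log |G mod m|` up to an error linear in `m`. -/
theorem hausdorffDim_eq_liminf {W : ℕ → ℝ} {K : ℝ} (hW0 : ∀ᶠ m in atTop, 0 ≤ W m)
    (hW1 : ∀ᶠ m in atTop, W m ≤ 2 ^ m) (hK : ∀ᶠ m : ℕ in atTop, |logCard ω m - W m| ≤ K * m) :
    hausdorffDim (spinalGroup ω) = liminf (fun m => W m / 2 ^ m) atTop := by
  rw [hausdorffDim_spinalGroup]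
  have hpow : ∀ m : ℕ, (0 : ℝ) < 2 ^ m := fun m => by positivity
  refine liminf_eq_of_tendsto_sub (c := 0) (C := 1) ?_ ?_ ?_
  · filter_upwards [hW0] with m hm
    exact div_nonneg hm (hpow m).le
  · filter_upwards [hW1] with m hm
    exact (div_le_one (hpow m)).2 hm
  have hlim : Tendsto (fun m : ℕ => 2 * K * ((m : ℝ) ^ 1 / 2 ^ m) + 2 * (1 / 2) ^ m)
      atTop (𝓝 0) := by
    have h1 := (tendsto_pow_const_div_const_pow_of_one_lt 1 (r := (2 : ℝ)) (by norm_num)).const_mul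
      (2 * K)
    have h2 := (tendsto_pow_atTop_nhds_zero_of_lt_one (r := (1 / 2 : ℝ)) (by norm_num)
      (by norm_num)).const_mul 2
    simpa using h1.add h2
  refine squeeze_zero_norm' ?_ hlim
  filter_upwards [hW0, hW1, hK, eventually_ge_atTop 1] with m h0 h1 h2 hm
  have hp := hpow m
  have h2m : (2 : ℝ) ≤ 2 ^ m := by
    calc (2 : ℝ) = 2 ^ 1 := by norm_num
      _ ≤ 2 ^ m := pow_le_pow_right₀ (by norm_num) hm
  have hq : (2 : ℝ) ^ m / 2 ≤ 2 ^ m - 1 := by linarith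
  have hq0 : (0 : ℝ) < 2 ^ m - 1 := by linarith
  -- Replacing the denominator 2^m - 1 by 2^m costs only `W m / 2 ^ m ≤ 1` in the numerator.
  have e : logCard ω m / (2 ^ m - 1) - W m / 2 ^ m =
      (logCard ω m - W m + W m / 2 ^ m) / (2 ^ m - 1) := by
    field_simp
    ring
  rw [e, Real.norm_eq_abs, abs_div, abs_of_pos hq0]
  have h3 : |logCard ω m - W m + W m / 2 ^ m| ≤ K * m + 1 := by
    refine (abs_add_le _ _).trans (add_le_add h2 ?_)
    rw [abs_of_nonneg (div_nonneg h0 hp.le)]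
    exact (div_le_one hp).2 h1
  calc |logCard ω m - W m + W m / 2 ^ m| / (2 ^ m - 1)
      ≤ (K * m + 1) / (2 ^ m / 2) :=
        div_le_div₀ ((abs_nonneg _).trans h3) h3 (by positivity) hq
    _ = 2 * K * ((m : ℝ) ^ 1 / 2 ^ m) + 2 * (1 / 2) ^ m := by
        rw [one_div_pow]; field_simp

/-- The sequence without its first `n` letters. -/
def tailSeq (ω : ℕ → Module.Dual (ZMod 2) B) (n : ℕ) : ℕ → Module.Dual (ZMod 2) B :=
  fun i => ω (i + n)

theorem shiftSeq_tailSeq (n : ℕ) : shiftSeq (tailSeq ω n) = tailSeq ω (n + 1) :=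
  funext fun i => congrArg ω (by omega)

theorem tailSeq_zero : tailSeq ω 0 = ω := rfl

theorem tailSeq_apply_zero (n : ℕ) : tailSeq ω n 0 = ω n := congrArg ω (zero_add n)

/-- The Hausdorff dimension when each letter is independent of the next `p - 1` letters and
depends on the next `p` letters. -/
theorem hausdorffDim_of_recurrent [FiniteDimensional (ZMod 2) B] {p : ℕ} (hω : ∀ n, ω n ≠ 0)
    (hne : ∀ n, ω (n + 1) ≠ ω n)
    (hnot : ∀ n, ω n ∉ Submodule.span (ZMod 2) ((fun i => ω (i + 1 + n)) '' {i | i < p - 1}))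
    (hmem : ∀ n, ω n ∈ Submodule.span (ZMod 2) ((fun i => ω (i + 1 + n)) '' {i | i < p})) :
    hausdorffDim (spinalGroup ω) = 1 - 3 / 2 ^ (p + 1) := by
  -- Up to level `p + 1` each letter is independent of the later visible ones, so the quotient has
  -- the same order as for Aut T.
  have small : ∀ m, ∀ n, m ≤ p → logCard (tailSeq ω n) (m + 1) = 2 ^ (m + 1) - 1 := by
    intro m
    induction m with
    | zero => intro n _; rw [logCard_one]; norm_num
    | succ m ih =>
      intro n hm
      rw [logCard_succ_of_notMem_span (by rw [tailSeq_apply_zero]; exact hω n) (by omega),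
        shiftSeq_tailSeq, ih _ (by omega)]
      · ring
      · rw [tailSeq_apply_zero]
        refine fun h => hnot n (Submodule.span_mono (Set.image_mono fun i hi => ?_) h)
        rw [Set.mem_ofPred_eq] at hi ⊢
        omega
  -- The recursion is now x ↦ 2x - 2, with fixed point 2; the coefficient of the power of 2 is set
  -- by the value 2^(p+1) - 1 on level `p + 1`.
  have large : ∀ m, ∀ n, logCard (tailSeq ω n) (p + 1 + m) =
      2 + (1 - 3 / 2 ^ (p + 1)) * 2 ^ (p + 1 + m) := by
    intro m
    induction m with
    | zero =>
      intro n
      rw [add_zero, small p n le_rfl]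
      field_simp
      ring
    | succ m ih =>
      intro n
      have h := logCard_of_repeat_of_mem_span (ω := tailSeq ω n) (r := 0) (j := p + 1 + m)
        (by rw [tailSeq_apply_zero]; exact hω n) (by omega) (by simp) ?_ ?_
      · rw [zero_add, shiftSeq_tailSeq, ih] at h
        rw [← add_assoc, h, pow_succ _ (p + 1 + m)]
        push_cast
        ring
      · rw [tailSeq_apply_zero, tailSeq, zero_add, add_comm 1 n]
        exact hne n
      · rw [tailSeq_apply_zero]
        refine Submodule.span_mono (Set.image_mono fun i hi => ?_) (hmem n)
        rw [Set.mem_ofPred_eq] at hi ⊢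
        omega
  -- For `p = 0` a non-zero letter would lie in the zero space; `1 ≤ p` is what makes the claimed
  -- dimension non-negative.
  have hp4 : 1 ≤ p := by
    by_contra h
    have h0 : p = 0 := by omega
    have := hmem 0
    rw [h0] at this
    simp at this
    exact hω 0 this
  have h4 : (4 : ℝ) ≤ 2 ^ (p + 1) := by
    calc (4 : ℝ) = 2 ^ 2 := by norm_num
      _ ≤ 2 ^ (p + 1) := pow_le_pow_right₀ (by norm_num) (by omega)
  have hc0 : (0 : ℝ) ≤ 1 - 3 / 2 ^ (p + 1) := by
    rw [sub_nonneg, div_le_one (by positivity)]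
    linarith
  have hc1 : 1 - 3 / 2 ^ (p + 1) ≤ (1 : ℝ) := by
    have : (0 : ℝ) ≤ 3 / 2 ^ (p + 1) := by positivity
    linarith
  rw [hausdorffDim_eq_liminf (W := fun m => (1 - 3 / 2 ^ (p + 1)) * 2 ^ m) (K := 2)]
  · have : (fun m : ℕ => (1 - 3 / 2 ^ (p + 1)) * 2 ^ m / 2 ^ m) =
        fun _ => (1 - 3 / 2 ^ (p + 1) : ℝ) := by
      funext m
      field_simp
    rw [this, liminf_const]
  · exact Eventually.of_forall fun m => mul_nonneg hc0 (by positivity)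
  · exact Eventually.of_forall fun m => mul_le_of_le_one_left (by positivity) hc1
  · filter_upwards [eventually_ge_atTop (p + 1)] with m hm
    obtain ⟨k, rfl⟩ := Nat.exists_eq_add_of_le hm
    have := large k 0
    rw [tailSeq_zero] at this
    rw [this, add_sub_cancel_right, abs_of_pos (by norm_num)]
    have : (1 : ℝ) ≤ ((p + 1 + k : ℕ) : ℝ) := by
      push_cast
      have : (0 : ℝ) ≤ p := Nat.cast_nonneg p
      have : (0 : ℝ) ≤ k := Nat.cast_nonneg k
      linarith
    linarith

end Spinal

/-! ### Linear algebra over the field with two elements. -/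

section Plane

variable {V : Type*} [AddCommGroup V] [Module (ZMod 2) V]

theorem notMem_span_singleton {x y : V} (hx : x ≠ 0) (hxy : x ≠ y) :
    x ∉ Submodule.span (ZMod 2) {y} := by
  rw [Submodule.mem_span_singleton]
  rintro ⟨c, hc⟩
  rcases zmod_two_eq_zero_or_one c with rfl | rfl
  · exact hx (by rw [← hc, zero_smul])
  · exact hxy (by rw [← hc, one_smul])

theorem mem_span_pair_of_finrank_eq_two {W : Submodule (ZMod 2) V}
    (hW : Module.finrank (ZMod 2) W = 2) {x y z : V} (hx : x ∈ W) (hy : y ∈ W) (hz : z ∈ W)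
    (hx0 : x ≠ 0) (hy0 : y ≠ 0) (hxy : x ≠ y) : z ∈ Submodule.span (ZMod 2) {x, y} := by
  have hli : LinearIndependent (ZMod 2) ![x, y] := by
    rw [LinearIndependent.pair_iff]
    intro s t hst
    rcases zmod_two_eq_zero_or_one s with rfl | rfl <;>
      rcases zmod_two_eq_zero_or_one t with rfl | rfl
    · exact ⟨rfl, rfl⟩
    · simp [hy0] at hst
    · simp [hx0] at hst
    · rw [one_smul, one_smul] at hst
      refine absurd ?_ hxy
      have h2 : y + y = 0 := by rw [← two_smul (ZMod 2) y]; exact zero_smul _ _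
      exact add_right_cancel (hst.trans h2.symm)
  have h1 := finrank_span_eq_card hli
  rw [Matrix.range_cons_cons_empty, Fintype.card_fin] at h1
  have hle : Submodule.span (ZMod 2) {x, y} ≤ W := by
    rw [Submodule.span_le]
    rintro _ (rfl | rfl)
    · exact hx
    · exact hy
  have : FiniteDimensional (ZMod 2) W := Module.finite_of_finrank_pos (by omega)
  rw [Submodule.eq_of_le_of_finrank_eq hle (h1.trans hW.symm)]
  exact hz

end Plane

/-! ### The Grigorchuk group and the groups G_n. -/

section Periodic

variable {B : Type*} [AddCommGroup B] [Module (ZMod 2) B] [FiniteDimensional (ZMod 2) B]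

theorem hausdorffDim_grigorchuk (hB : Module.finrank (ZMod 2) B = 2)
    (ψ : Fin 3 → Module.Dual (ZMod 2) B) (hinj : Function.Injective ψ) (h0 : ∀ j, ψ j ≠ 0)
    (hlt : ∀ i, i % 3 < 3) : hausdorffDim (spinalGroup fun i => ψ ⟨i % 3, hlt i⟩) = 5 / 8 := by
  have hdist : ∀ i j : ℕ, i % 3 ≠ j % 3 →
      ψ ⟨i % 3, hlt i⟩ ≠ ψ ⟨j % 3, hlt j⟩ :=
    fun i j hij h => hij (congrArg Fin.val (hinj h))
  rw [show (5 / 8 : ℝ) = 1 - 3 / 2 ^ (2 + 1) by norm_num]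
  refine hausdorffDim_of_recurrent (fun n => h0 _) (fun n => hdist _ _ (by omega)) ?_ ?_
  · intro n h
    refine notMem_span_singleton (h0 _) (hdist n (n + 1) (by omega)) (Submodule.span_mono ?_ h)
    rintro _ ⟨i, hi, rfl⟩
    have hi0 : i = 0 := by
      rw [Set.mem_ofPred_eq] at hi
      omega
    subst hi0
    simp [add_comm]
  · intro n
    refine Submodule.span_mono ?_ (mem_span_pair_of_finrank_eq_two (W := ⊤)
      (by rw [finrank_top, Subspace.dual_finrank_eq, hB])
      (x := ψ ⟨(0 + 1 + n) % 3, hlt _⟩)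
      (y := ψ ⟨(1 + 1 + n) % 3, hlt _⟩) trivial trivial trivial
      (h0 _) (h0 _) (hdist _ _ (by omega)))
    rintro _ (rfl | rfl)
    · exact ⟨0, by norm_num, rfl⟩
    · exact ⟨1, by norm_num, rfl⟩

theorem hausdorffDim_basis (n : ℕ) (hn : 2 ≤ n)
    (β : Module.Basis (Fin n) (ZMod 2) (Module.Dual (ZMod 2) B)) (hlt : ∀ i, i % n < n) :
    hausdorffDim (spinalGroup fun i => β ⟨i % n, hlt i⟩) = 1 - 3 / 2 ^ (n + 1) := by
  have hmod : ∀ i j : ℕ, i < n → 0 < i → (i + j) % n ≠ j % n := by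
    intro i j hi hi0 h
    have h1 : (i + j) % n = (0 + j) % n := by rwa [zero_add]
    have h2 : i ≡ 0 [MOD n] := Nat.ModEq.add_right_cancel' j h1
    have h3 := Nat.eq_zero_of_dvd_of_lt ((Nat.modEq_zero_iff_dvd).1 h2) hi
    omega
  refine hausdorffDim_of_recurrent (fun m => β.ne_zero _) (fun m h => ?_) (fun m h => ?_)
    fun m => ?_
  · have := congrArg Fin.val (β.injective h)
    rw [add_comm m 1] at this
    exact hmod 1 m (by omega) one_pos this
  · have hsub : (fun i => β ⟨(i + 1 + m) % n, hlt _⟩) '' {i | i < n - 1} ⊆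
        β '' {k | k ≠ ⟨m % n, hlt m⟩} := by
      rintro _ ⟨i, hi, rfl⟩
      refine ⟨_, fun hk => ?_, rfl⟩
      rw [Set.mem_ofPred_eq] at hi
      exact hmod (i + 1) m (by omega) (by omega) (congrArg Fin.val hk)
    exact β.linearIndependent.notMem_span_image (by simp) (Submodule.span_mono hsub h)
  · refine Submodule.subset_span ⟨n - 1, Nat.sub_lt (by omega) one_pos, ?_⟩
    beta_reduce
    congr 2
    rw [show n - 1 + 1 + m = m + n by omega, Nat.add_mod_right]

end Periodic

/-! ### The recursion with weights 2^n. -/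

section Scaled

variable {B : Type*} [AddCommGroup B] [Module (ZMod 2) B] {ω : ℕ → Module.Dual (ZMod 2) B}

/-- The contribution to `log |G_ω mod t|` of the sections at the vertices of level `n`. -/
noncomputable def scaledLog (ω : ℕ → Module.Dual (ZMod 2) B) (n t : ℕ) : ℝ :=
  2 ^ n * logCard (tailSeq ω n) (t - n)

/-- The weight 2^n absorbs the factor 2 of the recursion, so that steps simply add up. -/
theorem scaledLog_eq_of_step {n j : ℕ} {c : ℝ}
    (h : logCard (tailSeq ω n) (j + 1) = 2 * logCard (shiftSeq (tailSeq ω n)) j + c) :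
    scaledLog ω n (n + 1 + j) = scaledLog ω (n + 1) (n + 1 + j) + 2 ^ n * c := by
  rw [scaledLog, scaledLog, show n + 1 + j - n = j + 1 by omega, Nat.add_sub_cancel_left, h,
    shiftSeq_tailSeq, pow_succ]
  ring

theorem scaledLog_of_repeat_of_mem_span {n r t : ℕ} (h0 : ω n ≠ 0) (ht : n + r + 2 ≤ t)
    (hrep : ∀ i, n < i → i ≤ n + r → ω i = ω n) (hne : ω (n + r + 1) ≠ ω n)
    (h : ω n ∈ Submodule.span (ZMod 2) (ω '' {i | n + r < i ∧ i + 1 < t})) :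
    scaledLog ω n t = scaledLog ω (n + 1) t - 2 ^ n * (r + 2) := by
  obtain ⟨j, rfl⟩ := Nat.exists_eq_add_of_le ht
  have := scaledLog_eq_of_step (ω := ω) (n := n) (j := r + (j + 1)) (c := -(r + 2)) ?_
  · rw [show n + r + 2 + j = n + 1 + (r + (j + 1)) by ring, this]
    ring
  · rw [← sub_eq_add_neg]
    refine logCard_of_repeat_of_mem_span ?_ (by omega) (fun i hi => ?_) ?_ ?_
    · rwa [tailSeq_apply_zero]
    · rw [tailSeq_apply_zero]
      exact hrep _ (by omega) (by omega)
    · rw [tailSeq_apply_zero, tailSeq, show r + 1 + n = n + r + 1 by ring]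
      exact hne
    · rw [tailSeq_apply_zero]
      refine Submodule.span_mono ?_ h
      rintro _ ⟨i, ⟨hi, hi'⟩, rfl⟩
      refine ⟨i - (n + r + 1), ?_, congrArg ω (by omega)⟩
      rw [Set.mem_ofPred_eq]
      omega

variable [FiniteDimensional (ZMod 2) B]

theorem scaledLog_of_notMem_span {n t : ℕ} (h0 : ω n ≠ 0) (ht : n + 2 ≤ t)
    (h : ω n ∉ Submodule.span (ZMod 2) (ω '' {i | n < i ∧ i + 1 < t})) :
    scaledLog ω n t = scaledLog ω (n + 1) t + 2 ^ n := by
  obtain ⟨j, rfl⟩ := Nat.exists_eq_add_of_le ht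
  have := scaledLog_eq_of_step (ω := ω) (n := n) (j := j + 1) (c := 1) ?_
  · rw [show n + 2 + j = n + 1 + (j + 1) by ring, this, mul_one]
  · refine logCard_succ_of_notMem_span (by rwa [tailSeq_apply_zero]) (by omega) ?_
    rw [tailSeq_apply_zero]
    refine fun h' => h (Submodule.span_mono ?_ h')
    rintro _ ⟨i, hi, rfl⟩
    rw [Set.mem_ofPred_eq] at hi
    exact ⟨i + 1 + n, ⟨by omega, by omega⟩, rfl⟩

theorem scaledLog_of_repeat_of_notMem_span {n r t : ℕ} (h0 : ω n ≠ 0) (hr : 1 ≤ r)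
    (ht : n + r + 2 ≤ t) (hrep : ∀ i, n < i → i ≤ n + r → ω i = ω n)
    (h : ω n ∉ Submodule.span (ZMod 2) (ω '' {i | n + r < i ∧ i + 1 < t})) :
    scaledLog ω n t = scaledLog ω (n + 1) t - 2 ^ n * (r + 1) := by
  obtain ⟨j, rfl⟩ := Nat.exists_eq_add_of_le ht
  have := scaledLog_eq_of_step (ω := ω) (n := n) (j := r + (j + 1)) (c := -(r + 1)) ?_
  · rw [show n + r + 2 + j = n + 1 + (r + (j + 1)) by ring, this]
    ring
  · rw [← sub_eq_add_neg]
    refine logCard_of_repeat_of_notMem_span ?_ hr (by omega) (fun i hi => ?_) ?_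
    · rwa [tailSeq_apply_zero]
    · rw [tailSeq_apply_zero]
      exact hrep _ (by omega) (by omega)
    · rw [tailSeq_apply_zero]
      refine fun h' => h (Submodule.span_mono ?_ h')
      rintro _ ⟨i, hi, rfl⟩
      rw [Set.mem_ofPred_eq] at hi
      exact ⟨i + r + 1 + n, ⟨by omega, by omega⟩, rfl⟩

/-- Dropping the place `i` costs at most 2^i t. Hence finitely many initial letters do not affect
the dimension, and only the eventual behaviour of ω matters. -/
theorem abs_scaledLog_sub_le (hω : ∀ n, ω n ≠ 0) {n t : ℕ} (ht : n + 1 ≤ t) :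
    |logCard ω t - scaledLog ω n t| ≤ (2 ^ n - 1) * t := by
  induction n with
  | zero => simp [scaledLog, tailSeq_zero]
  | succ n ih =>
    have ih' := ih (by omega)
    obtain ⟨j, rfl⟩ := Nat.exists_eq_add_of_le (show n + 1 + 1 ≤ t from ht)
    have hb := logCard_succ_bounds (ω := tailSeq ω n) (by rw [tailSeq_apply_zero]; exact hω n)
      (show 1 ≤ j + 1 by omega)
    have hs := scaledLog_eq_of_step (ω := ω) (n := n) (j := j + 1)
      (c := logCard (tailSeq ω n) (j + 1 + 1) - 2 * logCard (shiftSeq (tailSeq ω n)) (j + 1))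
      (by ring)
    rw [show n + 1 + (j + 1) = n + 1 + 1 + j by ring] at hs
    have hstep : |scaledLog ω n (n + 1 + 1 + j) - scaledLog ω (n + 1) (n + 1 + 1 + j)| ≤
        2 ^ n * ((n + 1 + 1 + j : ℕ) : ℝ) := by
      rw [hs, add_sub_cancel_left, abs_mul, abs_of_pos (by positivity)]
      refine mul_le_mul_of_nonneg_left ?_ (by positivity)
      have hn : (0 : ℝ) ≤ n := Nat.cast_nonneg n
      have hj : (0 : ℝ) ≤ j := Nat.cast_nonneg j
      push_cast at hb ⊢
      rw [abs_le]
      constructor <;> linarith [hb.1, hb.2]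
    calc _ ≤ _ := abs_sub_le _ (scaledLog ω n (n + 1 + 1 + j)) _
      _ ≤ _ := add_le_add ih' hstep
      _ = _ := by rw [pow_succ]; ring

end Scaled

/-! ### Contributions of the syllables and the dimension formula. -/

section Syllables

variable {B : Type*} [AddCommGroup B] [Module (ZMod 2) B] {ω ψ : ℕ → Module.Dual (ZMod 2) B}
  {a : ℕ → ℕ}

theorem sylSum_succ (a : ℕ → ℕ) (k : ℕ) : sylSum a (k + 1) = sylSum a k + a k :=
  Finset.sum_range_succ _ _

theorem bigSigma_succ (a : ℕ → ℕ) (k : ℕ) :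
    bigSigma a (k + 1) = bigSigma a k + 2 ^ sylSum a k * a k :=
  Finset.sum_range_succ _ _

theorem bigSigma_le (a : ℕ → ℕ) (k : ℕ) : bigSigma a k ≤ 2 ^ sylSum a k := by
  induction k with
  | zero => simp [bigSigma]
  | succ k ih =>
    rw [bigSigma_succ, sylSum_succ, pow_add]
    calc _ ≤ 2 ^ sylSum a k + 2 ^ sylSum a k * a k := Nat.add_le_add_right ih _
      _ = 2 ^ sylSum a k * (a k + 1) := by ring
      _ ≤ _ := Nat.mul_le_mul_left _ (Nat.lt_two_pow_self)

namespace IsSyllableForm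

theorem sylSum_strictMono (h : IsSyllableForm ω ψ a) : StrictMono (sylSum a) :=
  strictMono_nat_of_lt_succ fun k => by
    rw [sylSum_succ]
    exact Nat.lt_add_of_pos_right (h.pos k)

theorem le_sylSum (h : IsSyllableForm ω ψ a) (k : ℕ) : k ≤ sylSum a k := h.sylSum_strictMono.id_le k

theorem apply_sylSum (h : IsSyllableForm ω ψ a) (k : ℕ) : ω (sylSum a k) = ψ k :=
  h.eq k _ le_rfl (h.sylSum_strictMono (Nat.lt_succ_self k))

theorem ne_zero (h : IsSyllableForm ω ψ a) (hω : ∀ i, ω i ≠ 0) (k : ℕ) : ψ k ≠ 0 := by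
  rw [← h.apply_sylSum]
  exact hω _

variable [FiniteDimensional (ZMod 2) B]

/-- All visible letters are equal, so the quotient is generated by two involutions: it is dihedral
of order 2^(m+3). -/
theorem logCard_partial (h : IsSyllableForm ω ψ a) (hω : ∀ i, ω i ≠ 0) {k : ℕ} (m n : ℕ)
    (hn : sylSum a k ≤ n) (hm : n + m + 1 ≤ sylSum a (k + 1)) :
    logCard (tailSeq ω n) (m + 2) = m + 3 := by
  induction m generalizing n with
  | zero =>
    rw [zero_add, logCard_succ_of_notMem_span (by rw [tailSeq_apply_zero]; exact hω n) le_rfl,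
      logCard_one]
    · norm_num
    · rw [tailSeq_apply_zero]
      simpa using hω n
  | succ m ih =>
    have hrep : ∀ i < m + 1, tailSeq ω n (i + 1) = tailSeq ω n 0 := fun i hi => by
      rw [tailSeq_apply_zero, tailSeq, h.eq k n hn (by omega), h.eq k _ (by omega) (by omega)]
    have := logCard_of_repeat_of_notMem_span (ω := tailSeq ω n) (r := m + 1) (j := 1)
      (by rw [tailSeq_apply_zero]; exact hω n) (by omega) le_rfl hrep
      (by rw [tailSeq_apply_zero]; simpa using hω n)
    rw [this, shiftSeq_tailSeq, ih (n + 1) (by omega) (by omega)]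
    push_cast
    ring

/-- The syllable that is cut by the level `t`. -/
theorem scaledLog_last (h : IsSyllableForm ω ψ a) (hω : ∀ i, ω i ≠ 0) {k t : ℕ}
    (ht : sylSum a k + 2 ≤ t) (ht' : t ≤ sylSum a (k + 1) + 1) :
    scaledLog ω (sylSum a k) t = 2 ^ sylSum a k * (t - sylSum a k + 1) := by
  obtain ⟨m, rfl⟩ := Nat.exists_eq_add_of_le ht
  rw [scaledLog, show sylSum a k + 2 + m - sylSum a k = m + 2 by omega,
    h.logCard_partial hω m _ le_rfl (by omega)]
  push_cast
  ring

/-- The syllable before the one that is cut by the level `t`. -/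
theorem scaledLog_middle (h : IsSyllableForm ω ψ a) (hω : ∀ i, ω i ≠ 0) {k t : ℕ}
    (ht : sylSum a (k + 1) + 2 ≤ t) (ht' : t ≤ sylSum a (k + 2) + 1) (r n : ℕ)
    (hn : sylSum a k ≤ n) (hr : n + r + 1 = sylSum a (k + 1)) :
    scaledLog ω n t = scaledLog ω (sylSum a (k + 1)) t - 2 ^ sylSum a (k + 1) +
      2 ^ n * (r + 3) := by
  -- After the syllable of `n`, level `t` shows only letters equal to `ψ (k + 1)`.
  have hnot : ω n ∉ Submodule.span (ZMod 2) (ω '' {i | n + r < i ∧ i + 1 < t}) := by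
    rw [h.eq k n hn (by omega)]
    refine fun hm => notMem_span_singleton (h.ne_zero hω k) (h.ne k) (Submodule.span_mono ?_ hm)
    rintro _ ⟨i, ⟨hi, hi'⟩, rfl⟩
    exact h.eq (k + 1) i (by omega) (show i < sylSum a (k + 2) by omega)
  -- The last letter of the syllable adds 2^n and an earlier one subtracts (r+1) 2^n; the closed
  -- form follows from 2(r+2) - (r+1) = r+3 at each earlier letter.
  induction r generalizing n with
  | zero =>
    rw [scaledLog_of_notMem_span (hω n) (by omega) hnot, ← hr]
    simp only [add_zero, pow_succ]
    push_cast
    ring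
  | succ r ih =>
    have hrep : ∀ i, n < i → i ≤ n + (r + 1) → ω i = ω n := fun i hi hi' => by
      rw [h.eq k n hn (by omega), h.eq k i (by omega) (by omega)]
    rw [scaledLog_of_repeat_of_notMem_span (hω n) (by omega) (by omega) hrep hnot,
      ih (n + 1) (by omega) (by omega)]
    · rw [pow_succ]
      push_cast
      ring
    · rwa [hrep (n + 1) (by omega) (by omega), show n + 1 + r = n + (r + 1) by ring]

omit [FiniteDimensional (ZMod 2) B] in
/-- A syllable that is followed by two syllables that are visible on the level `t`. -/
theorem scaledLog_full (h : IsSyllableForm ω ψ a) (hω : ∀ i, ω i ≠ 0) {k t : ℕ}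
    (hmem : ψ k ∈ Submodule.span (ZMod 2) {ψ (k + 1), ψ (k + 2)})
    (ht : sylSum a (k + 2) + 2 ≤ t) (c n : ℕ)
    (hn : sylSum a k ≤ n) (hc : n + c = sylSum a (k + 1)) :
    scaledLog ω n t = scaledLog ω (sylSum a (k + 1)) t - 3 * 2 ^ sylSum a (k + 1) +
      2 ^ n * (c + 3) := by
  have hlt : sylSum a (k + 1) < sylSum a (k + 2) := h.sylSum_strictMono (by omega)
  -- With `c` letters left the last two terms solve the recursion: they cancel at `c = 0`, and
  -- 2(c+3) - (c+2) = (c+1) + 3.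
  induction c generalizing n with
  | zero =>
    rw [← hc]
    simp only [add_zero]
    push_cast
    ring
  | succ c ih =>
    have hk : ω n = ψ k := h.eq k n hn (by omega)
    have hrep : ∀ i, n < i → i ≤ n + c → ω i = ω n := fun i hi hi' => by
      rw [hk, h.eq k i (by omega) (by omega)]
    rw [scaledLog_of_repeat_of_mem_span (r := c) (hω n) (by omega) hrep,
      ih (n + 1) (by omega) (by omega)]
    · rw [pow_succ]
      push_cast
      ring
    · rw [hk, show n + c + 1 = sylSum a (k + 1) by omega, h.apply_sylSum]
      exact (h.ne k).symm
    · rw [hk]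
      refine Submodule.span_mono ?_ hmem
      rintro _ (rfl | rfl)
      · exact ⟨sylSum a (k + 1), ⟨by omega, by omega⟩, h.apply_sylSum _⟩
      · exact ⟨sylSum a (k + 2), ⟨by omega, by omega⟩, h.apply_sylSum _⟩

/-- The main term of `log |G mod t|` when the level `t` cuts the syllable of index `k + 1`. -/
noncomputable def mainTerm (a : ℕ → ℕ) (k t : ℕ) : ℝ :=
  2 ^ sylSum a (k + 1) * (t - sylSum a (k + 1)) + bigSigma a (k + 1) - 2 ^ sylSum a k

/-- A full syllable contributes 2^(s_i) (a_i + 3) - 3 · 2^(s_{i+1}): the multiples of 3 telescope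
and the terms 2^(s_i) a_i build up Σ. What remains at the lower end depends only on `N`. -/
theorem scaledLog_eq_mainTerm (h : IsSyllableForm ω ψ a) (hω : ∀ i, ω i ≠ 0) {N k t : ℕ}
    (hmem : ∀ k, N ≤ k → ψ k ∈ Submodule.span (ZMod 2) {ψ (k + 1), ψ (k + 2)}) (hNk : N ≤ k)
    (ht : sylSum a (k + 1) + 2 ≤ t) (ht' : t ≤ sylSum a (k + 2) + 1) :
    scaledLog ω (sylSum a N) t =
      mainTerm a k t + 3 * 2 ^ sylSum a N - bigSigma a N := by
  have key : ∀ d i, i + d = k → N ≤ i → scaledLog ω (sylSum a i) t =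
      mainTerm a k t + 3 * 2 ^ sylSum a i - bigSigma a i := by
    intro d
    induction d with
    | zero =>
      intro i hi _
      obtain rfl : i = k := by omega
      have hp := h.pos i
      have hs := sylSum_succ a i
      rw [h.scaledLog_middle hω ht ht' (a i - 1) (sylSum a i) le_rfl (by omega),
        h.scaledLog_last hω ht ht', mainTerm, bigSigma_succ, Nat.cast_sub hp]
      push_cast
      ring
    | succ d ih =>
      intro i hi hNi
      have hs := sylSum_succ a i
      have hle : sylSum a (i + 2) ≤ sylSum a (k + 1) := h.sylSum_strictMono.monotone (by omega)
      rw [h.scaledLog_full hω (hmem i hNi) (by omega) (a i) (sylSum a i) le_rfl hs.symm,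
        ih (i + 1) (by omega) (by omega), bigSigma_succ]
      push_cast
      ring
  exact key (k - N) N (by omega) le_rfl

end IsSyllableForm

open IsSyllableForm

theorem mainTerm_nonneg {k t : ℕ} (ht : sylSum a (k + 1) + 2 ≤ t) : 0 ≤ mainTerm a k t := by
  have h1 : (2 : ℝ) ^ sylSum a k ≤ 2 ^ sylSum a (k + 1) :=
    pow_le_pow_right₀ (by norm_num) (by rw [sylSum_succ]; omega)
  have h2 : (0 : ℝ) ≤ bigSigma a (k + 1) := Nat.cast_nonneg _
  have h3 : ((sylSum a (k + 1) : ℝ)) + 2 ≤ t := by exact_mod_cast ht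
  have h4 : (0 : ℝ) < 2 ^ sylSum a (k + 1) := by positivity
  rw [mainTerm]
  nlinarith

theorem mainTerm_le {k t : ℕ} (ht : sylSum a (k + 1) + 2 ≤ t) : mainTerm a k t ≤ 2 ^ t := by
  have h1 : (0 : ℝ) < 2 ^ sylSum a k := by positivity
  have h2 : (bigSigma a (k + 1) : ℝ) ≤ 2 ^ sylSum a (k + 1) := by
    exact_mod_cast bigSigma_le a (k + 1)
  obtain ⟨d, rfl⟩ := Nat.exists_eq_add_of_le (show sylSum a (k + 1) ≤ t by omega)
  have h3 : (d : ℝ) + 1 ≤ 2 ^ d := by exact_mod_cast Nat.lt_two_pow_self (n := d)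
  have h4 : (0 : ℝ) < 2 ^ sylSum a (k + 1) := by positivity
  rw [mainTerm, pow_add]
  push_cast
  nlinarith

/-- Raising `t` by one adds 2^(s_{k+1}), which is at most the main term once t ≥ s_{k+1} + 2; so the
main term at most doubles. -/
theorem mainTerm_div_antitone {k t t' : ℕ} (ht : sylSum a (k + 1) + 2 ≤ t) (htt : t ≤ t') :
    mainTerm a k t' / 2 ^ t' ≤ mainTerm a k t / 2 ^ t := by
  induction t', htt using Nat.le_induction with
  | base => exact le_rfl
  | succ t' htt ih =>
    refine le_trans ?_ ih
    have h1 : (2 : ℝ) ^ sylSum a k ≤ 2 ^ sylSum a (k + 1) :=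
      pow_le_pow_right₀ (by norm_num) (by rw [sylSum_succ]; omega)
    have h2 : (0 : ℝ) ≤ bigSigma a (k + 1) := Nat.cast_nonneg _
    have h3 : ((sylSum a (k + 1) : ℝ)) + 2 ≤ t' := by exact_mod_cast ht.trans htt
    have h4 : (0 : ℝ) < 2 ^ sylSum a (k + 1) := by positivity
    rw [div_le_div_iff₀ (by positivity) (by positivity), pow_succ, ← mul_assoc, mul_right_comm]
    refine mul_le_mul_of_nonneg_right ?_ (by positivity)
    rw [mainTerm, mainTerm]
    push_cast
    nlinarith

theorem mainTerm_div_eq (k : ℕ) :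
    mainTerm a k (sylSum a (k + 2) + 1) / 2 ^ (sylSum a (k + 2) + 1) =
      1 / 2 * ((bigSigma a (k + 2) : ℝ) / 2 ^ sylSum a (k + 2) +
        1 / 2 ^ a (k + 1) * (1 - 1 / 2 ^ a k)) := by
  rw [mainTerm, bigSigma_succ a (k + 1), sylSum_succ a (k + 1), sylSum_succ a k]
  push_cast
  rw [pow_succ, pow_add, pow_add]
  field_simp
  ring

open Topology in
theorem hausdorffDim_of_isSyllableForm [FiniteDimensional (ZMod 2) B]
    (h : IsSyllableForm ω ψ a) (hω : ∀ i, ω i ≠ 0) {N : ℕ}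
    (hmem : ∀ k, N ≤ k → ψ k ∈ Submodule.span (ZMod 2) {ψ (k + 1), ψ (k + 2)}) :
    hausdorffDim (spinalGroup ω) = 1 / 2 * liminf (fun k : ℕ =>
      (bigSigma a (k + 2) : ℝ) / 2 ^ sylSum a (k + 2) +
        1 / 2 ^ a (k + 1) * (1 - 1 / 2 ^ a k)) atTop := by
  have hex : ∀ t, ∃ k, t ≤ sylSum a (k + 2) + 1 := fun t =>
    ⟨t, by have := h.le_sylSum (t + 2); omega⟩
  classical
  -- The last letter visible on level `t` has index `t - 2`, so the syllable `κ t + 1` is the one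
  -- cut by `t` once t ≥ s_1 + 2.
  set κ : ℕ → ℕ := fun t => Nat.find (hex t) with hκdef
  have hκ1 : ∀ t, t ≤ sylSum a (κ t + 2) + 1 := fun t => Nat.find_spec (hex t)
  have hκ2 : ∀ k t, sylSum a (k + 1) + 2 ≤ t → k ≤ κ t := by
    intro k t ht
    by_contra hlt
    have h1 := hκ1 t
    have h2 : sylSum a (κ t + 2) ≤ sylSum a (k + 1) := h.sylSum_strictMono.monotone (by omega)
    omega
  have hκ3 : ∀ t, sylSum a 1 + 2 ≤ t → sylSum a (κ t + 1) + 2 ≤ t := by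
    intro t ht
    rcases Nat.eq_zero_or_pos (κ t) with h0 | h0
    · rwa [h0]
    · have := Nat.find_min (hex t) (Nat.sub_lt h0 one_pos)
      change ¬ t ≤ sylSum a (κ t - 1 + 2) + 1 at this
      rw [show κ t - 1 + 2 = κ t + 1 by omega] at this
      omega
  -- The level on which the syllable `k + 1` has just become entirely visible; there the ratio is
  -- smallest within the syllable.
  set τ : ℕ → ℕ := fun k => sylSum a (k + 2) + 1 with hτdef
  have hτ : Tendsto τ atTop atTop :=
    tendsto_atTop_mono (fun k => show k ≤ sylSum a (k + 2) + 1 by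
      have := h.le_sylSum (k + 2)
      omega) tendsto_id
  have hκτ : ∀ k, κ (τ k) = k := by
    intro k
    refine le_antisymm (Nat.find_le le_rfl) (hκ2 k _ ?_)
    have := h.sylSum_strictMono (show k + 1 < k + 2 by omega)
    simp only [hτdef]
    omega
  have hκ : Tendsto κ atTop atTop := by
    refine tendsto_atTop.2 fun k => ?_
    filter_upwards [eventually_ge_atTop (sylSum a (k + 1) + 2)] with t ht
    exact hκ2 k t ht
  have hW0 : ∀ᶠ t in atTop, 0 ≤ mainTerm a (κ t) t := by
    filter_upwards [eventually_ge_atTop (sylSum a 1 + 2)] with t ht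
    exact mainTerm_nonneg (hκ3 t ht)
  have hW1 : ∀ᶠ t in atTop, mainTerm a (κ t) t ≤ 2 ^ t := by
    filter_upwards [eventually_ge_atTop (sylSum a 1 + 2)] with t ht
    exact mainTerm_le (hκ3 t ht)
  rw [hausdorffDim_eq_liminf hW0 hW1
    (K := 2 ^ sylSum a N - 1 + |3 * 2 ^ sylSum a N - (bigSigma a N : ℝ)|)]
  · rw [liminf_eq_liminf_comp (c := 0) (C := 1) ?_ ?_ hτ hκ ?_]
    · have e : ((fun t => mainTerm a (κ t) t / 2 ^ t) ∘ τ) = fun k => 1 / 2 *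
          ((bigSigma a (k + 2) : ℝ) / 2 ^ sylSum a (k + 2) +
            1 / 2 ^ a (k + 1) * (1 - 1 / 2 ^ a k)) := by
        funext k
        rw [Function.comp_apply, hκτ]
        exact mainTerm_div_eq k
      rw [e]
      have hb0 : ∀ k, (0 : ℝ) ≤ (bigSigma a (k + 2) : ℝ) / 2 ^ sylSum a (k + 2) +
          1 / 2 ^ a (k + 1) * (1 - 1 / 2 ^ a k) := by
        intro k
        have h1 : (1 : ℝ) / 2 ^ a k ≤ 1 := by
          rw [div_le_one (by positivity)]
          exact one_le_pow₀ (by norm_num)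
        have : (0 : ℝ) ≤ 1 - 1 / 2 ^ a k := by linarith
        positivity
      have hb1 : ∀ k, (bigSigma a (k + 2) : ℝ) / 2 ^ sylSum a (k + 2) +
          1 / 2 ^ a (k + 1) * (1 - 1 / 2 ^ a k) ≤ 2 := by
        intro k
        have h1 : (bigSigma a (k + 2) : ℝ) / 2 ^ sylSum a (k + 2) ≤ 1 := by
          rw [div_le_one (by positivity)]
          exact_mod_cast bigSigma_le a (k + 2)
        have h2 : (1 : ℝ) / 2 ^ a (k + 1) ≤ 1 := by
          rw [div_le_one (by positivity)]
          exact one_le_pow₀ (by norm_num)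
        have h3 : (0 : ℝ) ≤ 1 / 2 ^ a k := by positivity
        have h4 : (0 : ℝ) ≤ 1 / 2 ^ a (k + 1) := by positivity
        nlinarith
      have hmono : Monotone fun x : ℝ => 1 / 2 * x := fun x y hxy => by
        beta_reduce; linarith
      exact (hmono.map_liminf_of_continuousAt _ (by fun_prop)
        (isBoundedUnder_of ⟨2, hb1⟩).isCoboundedUnder_ge (isBoundedUnder_of ⟨0, hb0⟩)).symm
    · filter_upwards [hW0] with t ht
      positivity
    · filter_upwards [hW1] with t ht
      exact (div_le_one (by positivity)).2 ht
    · filter_upwards [eventually_ge_atTop (sylSum a 1 + 2)] with t ht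
      rw [hκτ]
      exact mainTerm_div_antitone (hκ3 t ht) (hκ1 t)
  -- The constant `K` collects the cost of dropping the first s_N letters and the boundary term at
  -- `N` left by the telescoping.
  · filter_upwards [eventually_ge_atTop (sylSum a (N + 1) + 2)] with t ht
    have hNN : sylSum a N < sylSum a (N + 1) := h.sylSum_strictMono (by omega)
    have h1N : sylSum a 1 ≤ sylSum a (N + 1) := h.sylSum_strictMono.monotone (by omega)
    have h1 := abs_scaledLog_sub_le hω (n := sylSum a N) (t := t) (by omega)
    rw [h.scaledLog_eq_mainTerm hω hmem (hκ2 N t ht) (hκ3 t (by omega)) (hκ1 t)] at h1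
    have ht1 : (1 : ℝ) ≤ t := by exact_mod_cast (show 1 ≤ t by omega)
    have h2 := abs_nonneg (3 * 2 ^ sylSum a N - (bigSigma a N : ℝ))
    calc |logCard ω t - mainTerm a (κ t) t|
        = |(logCard ω t - (mainTerm a (κ t) t + 3 * 2 ^ sylSum a N - bigSigma a N)) +
            (3 * 2 ^ sylSum a N - bigSigma a N)| := by congr 1; ring
      _ ≤ (2 ^ sylSum a N - 1) * t + |3 * 2 ^ sylSum a N - (bigSigma a N : ℝ)| :=
          (abs_add_le _ _).trans (add_le_add_left h1 _)
      _ ≤ _ := by nlinarith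

end Syllables

/-! ### Eventual span of the letters and existence of the syllable form. -/

section Diminf

variable {B : Type*} [AddCommGroup B] [Module (ZMod 2) B] [FiniteDimensional (ZMod 2) B]
  {ω : ℕ → Module.Dual (ZMod 2) B}

/-- The span of the letters of the sequence from the place `n` on. -/
def tailSpan (ω : ℕ → Module.Dual (ZMod 2) B) (n : ℕ) :
    Submodule (ZMod 2) (Module.Dual (ZMod 2) B) :=
  Submodule.span (ZMod 2) (Set.range (tailSeq ω n))

omit [FiniteDimensional (ZMod 2) B] in
theorem mem_tailSpan {n i : ℕ} (h : n ≤ i) : ω i ∈ tailSpan ω n :=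
  Submodule.subset_span ⟨i - n, congrArg ω (by omega)⟩

omit [FiniteDimensional (ZMod 2) B] in
theorem tailSpan_antitone : Antitone (tailSpan ω) := fun m n h => by
  refine Submodule.span_le.2 ?_
  rintro _ ⟨i, rfl⟩
  exact mem_tailSpan (by omega)

/-- The spans of the prefixes increase in a finite-dimensional space, so they stabilize, and the
limit is attained. -/
theorem limUnder_dimMod (n : ℕ) :
    (limUnder atTop fun m : ℕ => dimMod (fun i => ω (i + n)) m) =
      Module.finrank (ZMod 2) (tailSpan ω n) := by
  set U : ℕ →o Submodule (ZMod 2) (Module.Dual (ZMod 2) B) :=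
    ⟨fun m => Submodule.span (ZMod 2) (tailSeq ω n '' {i | i < m - 1}), fun m m' h =>
      Submodule.span_mono (Set.image_mono fun i hi => by
        rw [Set.mem_ofPred_eq] at hi ⊢
        omega)⟩ with hU
  obtain ⟨M, hM⟩ := monotone_stabilizes_iff_noetherian.2 inferInstance U
  have hMU : U M = tailSpan ω n := by
    refine le_antisymm (Submodule.span_mono (Set.image_subset_range _ _)) ?_
    refine Submodule.span_le.2 ?_
    rintro _ ⟨i, rfl⟩
    -- Index `i + 2` suffices since the `m`-th space contains the letters of index less than `m -
    -- 1`.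
    have h1 : tailSeq ω n i ∈ U (max M (i + 2)) :=
      Submodule.subset_span ⟨i, by rw [Set.mem_ofPred_eq]; omega, rfl⟩
    rwa [← hM _ (le_max_left _ _)] at h1
  refine (tendsto_atTop_of_eventually_const (i₀ := M) fun m hm => ?_).limUnder_eq
  rw [← hMU, hM m hm]
  rfl

/-- The dimensions of the tail spans decrease in ℕ, hence are eventually constant, so the liminf is
an eventual value. -/
theorem exists_finrank_tailSpan_eq_diminf (ω : ℕ → Module.Dual (ZMod 2) B) :
    ∃ N, ∀ n, N ≤ n → Module.finrank (ZMod 2) (tailSpan ω n) = diminf ω := by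
  obtain ⟨N, hN⟩ : ∃ N, ∀ n, Module.finrank (ZMod 2) (tailSpan ω N) ≤
      Module.finrank (ZMod 2) (tailSpan ω n) :=
    ⟨Function.argmin (fun n => Module.finrank (ZMod 2) (tailSpan ω n)), fun n =>
      Function.argmin_le (fun n => Module.finrank (ZMod 2) (tailSpan ω n)) n⟩
  have hconst : ∀ n, N ≤ n →
      Module.finrank (ZMod 2) (tailSpan ω n) = Module.finrank (ZMod 2) (tailSpan ω N) :=
    fun n hn => le_antisymm (Submodule.finrank_mono (tailSpan_antitone hn)) (hN n)
  refine ⟨N, fun n hn => ?_⟩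
  rw [hconst n hn, diminf]
  simp_rw [limUnder_dimMod]
  rw [liminf_congr (v := fun _ => Module.finrank (ZMod 2) (tailSpan ω N)), liminf_const]
  filter_upwards [eventually_ge_atTop N] with m hm
  exact hconst m hm

theorem exists_ne_of_diminf_eq_two (h : diminf ω = 2) (n : ℕ) : ∃ m, n < m ∧ ω m ≠ ω n := by
  by_contra hne
  push Not at hne
  obtain ⟨N, hN⟩ := exists_finrank_tailSpan_eq_diminf ω
  have h2 := hN (max N (n + 1)) (le_max_left _ _)
  rw [h] at h2
  have hle : tailSpan ω (max N (n + 1)) ≤ Submodule.span (ZMod 2) {ω n} := by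
    refine Submodule.span_mono ?_
    rintro _ ⟨i, rfl⟩
    exact hne _ (by omega)
  have h3 := (Submodule.finrank_mono hle).trans (finrank_span_le_card {ω n})
  simp at h3
  omega

omit [FiniteDimensional (ZMod 2) B] in
theorem exists_isSyllableForm (h : ∀ n, ∃ m, n < m ∧ ω m ≠ ω n) :
    ∃ ψ a, IsSyllableForm ω ψ a := by
  classical
  set next : ℕ → ℕ := fun n => Nat.find (h n) with hnext
  have hlt : ∀ n, n < next n := fun n => (Nat.find_spec (h n)).1
  have hne : ∀ n, ω (next n) ≠ ω n := fun n => (Nat.find_spec (h n)).2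
  have heq : ∀ n i, n ≤ i → i < next n → ω i = ω n := by
    intro n i hni hi
    rcases hni.eq_or_lt with rfl | hni
    · rfl
    · by_contra hc
      exact Nat.find_min (h n) hi ⟨hni, hc⟩
  set s : ℕ → ℕ := fun k => next^[k] 0 with hs
  have hsucc : ∀ k, s (k + 1) = next (s k) := fun k => Function.iterate_succ_apply' next k 0
  have hsum : ∀ k, sylSum (fun k => s (k + 1) - s k) k = s k := by
    intro k
    induction k with
    | zero => rfl
    | succ k ih =>
      rw [sylSum_succ, ih]
      have := hlt (s k)
      rw [← hsucc] at this
      omega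
  refine ⟨fun k => ω (s k), fun k => s (k + 1) - s k, fun k => ?_, fun k => ?_, fun k i hi hi' => ?_⟩
  · have := hlt (s k)
    rw [← hsucc] at this
    omega
  · rw [hsucc]
    exact (hne _).symm
  · rw [hsum] at hi hi'
    rw [hsucc] at hi'
    exact heq _ _ hi hi'

/-- From some place on all letters lie in a plane, and the letters of two consecutive syllables,
being distinct and non-zero, span it. The syllable `k` starts at a place at least `k`, so the same
`N` bounds the syllables. -/
theorem hausdorffDim_of_diminf_eq_two {ψ : ℕ → Module.Dual (ZMod 2) B} {a : ℕ → ℕ}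
    (hω : ∀ i, ω i ≠ 0) (hd : diminf ω = 2) (h : IsSyllableForm ω ψ a) :
    hausdorffDim (spinalGroup ω) = 1 / 2 * liminf (fun k : ℕ =>
      (bigSigma a (k + 2) : ℝ) / 2 ^ sylSum a (k + 2) +
        1 / 2 ^ a (k + 1) * (1 - 1 / 2 ^ a k)) atTop := by
  obtain ⟨N, hN⟩ := exists_finrank_tailSpan_eq_diminf ω
  have hmem : ∀ k, N ≤ k → ψ k ∈ tailSpan ω N := fun k hk => by
    rw [← h.apply_sylSum]
    exact mem_tailSpan (hk.trans (h.le_sylSum k))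
  refine hausdorffDim_of_isSyllableForm h hω (N := N) fun k hk => ?_
  exact mem_span_pair_of_finrank_eq_two ((hN N le_rfl).trans hd) (hmem _ (by omega))
    (hmem _ (by omega)) (hmem k hk) (h.ne_zero hω _) (h.ne_zero hω _) (h.ne _)

end Diminf

theorem corollary4p5 {B : Type*} [AddCommGroup B] [Module (ZMod 2) B]
    [FiniteDimensional (ZMod 2) B] :
    -- the sequences of non-trivial functionals with `diminf ω = 2`, their syllable form
    -- exists, and it gives the dimension
    (∀ ω : ℕ → Module.Dual (ZMod 2) B, (∀ i, ω i ≠ 0) → diminf ω = 2 →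
      (∃ ψ a, IsSyllableForm ω ψ a) ∧
      ∀ ψ a, IsSyllableForm ω ψ a →
        hausdorffDim (spinalGroup ω) =
          1 / 2 * Filter.liminf (fun k : ℕ =>
            (bigSigma a (k + 2) : ℝ) / 2 ^ sylSum a (k + 2) +
              1 / 2 ^ a (k + 1) * (1 - 1 / 2 ^ a k)) Filter.atTop) ∧
    -- the first Grigorchuk group: `B` is a plane, and its three non-trivial functionals are
    -- repeated cyclically
    (Module.finrank (ZMod 2) B = 2 →
      ∀ ψ : Fin 3 → Module.Dual (ZMod 2) B, Function.Injective ψ → (∀ j, ψ j ≠ 0) →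
        hausdorffDim (spinalGroup fun i => ψ ⟨i % 3, Nat.mod_lt i (by omega)⟩) = 5 / 8) ∧
    -- the groups `G_n`: a basis of the dual space is repeated cyclically
    (∀ (n : ℕ) (hn : 2 ≤ n) (β : Module.Basis (Fin n) (ZMod 2) (Module.Dual (ZMod 2) B)),
      hausdorffDim (spinalGroup fun i => β ⟨i % n, Nat.mod_lt i (by omega)⟩) =
        1 - 3 / 2 ^ (n + 1)) :=
  ⟨fun _ hω hd => ⟨exists_isSyllableForm (exists_ne_of_diminf_eq_two hd),
      fun _ _ h => hausdorffDim_of_diminf_eq_two hω hd h⟩,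
    fun hB ψ hinj h0 => hausdorffDim_grigorchuk hB ψ hinj h0 _,
    fun n hn β => hausdorffDim_basis n hn β _⟩
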